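/- Let $n\ge 1$, let $N=2n+1$ (type $B$) or $N=2n$ (type $D$), work over the field $\mathbb{C}(q^{1/2})$ and put $\xi=q^{2-N}$, $i'=N+1-i$. Let $(\bar 1,\dots,\bar N)=(n-\tfrac12,\dots,\tfrac12,0,-\tfrac12,\dots,-n+\tfrac12)$ in type $B$ and $(n-1,\dots,1,0,0,-1,\dots,-n+1)$ in type $D$; let $D=\mathrm{diag}[q^{\bar1},\dots,q^{\bar N}]$, and let $\mathrm t$ be the matrix transposition with $e_{ij}^{\mathrm t}=e_{j'i'}$. In $\mathrm{End}\,\mathbb{C}^N\otimes\mathrm{End}\,\mathbb{C}^N$ set $P=\sum_{i,j}e_{ij}\otimes e_{ji}$, $Q=\sum_{i,j}q^{\bar\imath-\bar\jmath}e_{i'j'}\otimes e_{ij}$ and $$R=q\sum_{i\ne i'}e_{ii}\otimes e_{ii}+\sum_{i=i'}e_{ii}\otimes e_{ii}+\sum_{i\ne j,j'}e_{ii}\otimes e_{jj}+q^{-1}\sum_{i\ne i'}e_{ii}\otimes e_{i'i'}+(q-q^{-1})\sum_{i<j}e_{ij}\otimes e_{ji}-(q-q^{-1})\sum_{i>j}q^{\bar\imath-\bar\jmath}e_{i'j'}\otimes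 e_{ij}.$$ Let $f(u)$ be the power series with $f(0)=1$ and $f(u)f(u\xi)=\big((1-uq^{-2})(1-uq^2)(1-u\xi)(1-u\xi^{-1})\big)^{-1}$, and set $$\overline R(u)=\frac{u-1}{uq-q^{-1}}R+\frac{q-q^{-1}}{uq-q^{-1}}P-\frac{(q-q^{-1})(u-1)\xi}{(uq-q^{-1})(u-\xi)}Q,$$ $$R(u)=f(u)\big(q^{-1}(u-1)(u-\xi)R-(q^{-2}-1)(u-\xi)P+(q^{-2}-1)(u-1)\xi Q\big),$$ both expanded as power series in $u$. The algebra $U(R)$ is generated by an invertible central element $q^{c/2}$ and elements $l^{\pm}_{ij}[\mp m]$ ($1\le i,j\le N$, $m\ge0$), combined into the matrices $L^\pm(u)=[l^\pm_{ij}(u)]$ with $l^\pm_{ij}(u)=\sum_{m\ge0}l^\pm_{ij}[\mp m]u^{\pm m}$, subject to $l^+_{ii}[0]l^-_{ii}[0]=l^-_{ii}[0]l^+_{ii}[0]=1$, to $$R(u/v)L_1^\pm(u)L_2^\pm(v)=L_2^\pm(v)L_1^\pm(u)R(u/v),\qquad R(uq^c/v)L_1^+(u)L_2^-(v)=L_2^-(v)L_1^+(u)R(uq^{-c}/v),$$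 and to the triangularity conditions $l^+_{ij}[0]=l^-_{ji}[0]=0$, imposed either for all $i>j$ or for all $i<j$ (the result holds for both conventions). The algebra $U(\overline R)$ is defined in the same way with $\overline R(u)$ in place of $R(u)$; its generator matrices are denoted by $\mathcal L^\pm(u)$. Then the matrices $L^\pm(u)$ and $\mathcal L^\pm(u)$ have unique Gauss decompositions $L^\pm(u)=F^\pm(u)H^\pm(u)E^\pm(u)$ and $\mathcal L^\pm(u)=\mathcal F^\pm(u)\mathcal H^\pm(u)\mathcal E^\pm(u)$ with lower unitriangular $F^\pm,\mathcal F^\pm$, upper unitriangular $E^\pm,\mathcal E^\pm$ and diagonal $H^\pm(u)=\mathrm{diag}[h^\pm_1(u),\dots,h^\pm_N(u)]$, $\mathcal H^\pm(u)=\mathrm{diag}[\mathfrak h^\pm_1(u),\dots,\mathfrak h^\pm_N(u)]$ with invertible diagonal entries, and there are unique series $z^\pm(u)$ and $\mathfrak z^\pm(u)$ with coefficients in $U(R)$ and $U(\overline R)$, respectively, such that $$DL^\pm(u\xi)^{\mathrm t}D^{-1}L^\pm(u)=L^\pm(u)DL^\pm(u\xi)^{\mathrm t}D^{-1}=z^\pm(u)\,1,$$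 $$D\mathcal L^\pm(u\xi)^{\mathrm t}D^{-1}\mathcal L^\pm(u)=\mathcal L^\pm(u)D\mathcal L^\pm(u\xi)^{\mathrm t}D^{-1}=\mathfrak z^\pm(u)\,1.$$ They are given by $$z^\pm(u)=\prod_{i=1}^n h_i^\pm(u\xi q^{2i})^{-1}\prod_{i=1}^n h_i^\pm(u\xi q^{2i-2})\cdot h^\pm_{n+1}(u)h^\pm_{n+1}(uq),$$ $$\mathfrak z^\pm(u)=\prod_{i=1}^n \mathfrak h_i^\pm(u\xi q^{2i})^{-1}\prod_{i=1}^n \mathfrak h_i^\pm(u\xi q^{2i-2})\cdot \mathfrak h^\pm_{n+1}(u)\mathfrak h^\pm_{n+1}(uq)$$ in type $B$, and by $$z^\pm(u)=\prod_{i=1}^{n-1} h_i^\pm(u\xi q^{2i})^{-1}\prod_{i=1}^{n-1} h_i^\pm(u\xi q^{2i-2})\cdot h^\pm_{n}(u)h^\pm_{n+1}(u),$$ $$\mathfrak z^\pm(u)=\prod_{i=1}^{n-1} \mathfrak h_i^\pm(u\xi q^{2i})^{-1}\prod_{i=1}^{n-1} \mathfrak h_i^\pm(u\xi q^{2i-2})\cdot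 \mathfrak h^\pm_{n}(u)\mathfrak h^\pm_{n+1}(u)$$ in type $D$, where the factors are multiplied in the order in which they are written, with $i$ increasing from left to right in each product. -/

import Mathlib

open scoped Kronecker PowerSeries

noncomputable section

namespace QAffine

/-! ### The base field `ℂ(q^{1/2})` and the scalar data -/

/-- The base field `ℂ(q^{1/2})`; its generator is `s = q^{1/2}`. -/
abbrev K : Type := RatFunc ℂ

/-- `s = q^{1/2}`. -/
def s : K := RatFunc.X

/-- The parameter `q`. -/
def q : K := s ^ 2

/-- `ξ = q^{2-N}`. -/
def xi (N : ℕ) : K := q ^ (2 - (N : ℤ))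

/-- The integer `2 ī`. With indices counted from `0`, so that `i' = N - 1 - i = Fin.rev i`,
this gives `ī = (n - 1/2, …, 1/2, 0, -1/2, …, -n + 1/2)` for `N = 2n+1` and
`ī = (n - 1, …, 1, 0, 0, -1, …, -n + 1)` for `N = 2n`. -/
def bar2 {N : ℕ} (i : Fin N) : ℤ :=
  if i < i.rev then (N : ℤ) - 2 - 2 * (i : ℤ)
  else if i = i.rev then 0
  else (N : ℤ) - 2 * (i : ℤ)

/-- `q^{ī}`. -/
def qbar {N : ℕ} (i : Fin N) : K := s ^ bar2 i

/-! ### The `R`-matrices -/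

/-- Matrices over `𝕜` of size `N² × N²`, i.e. `End 𝕜^N ⊗ End 𝕜^N`. -/
abbrev Mat2 (N : ℕ) (𝕜 : Type) : Type := Matrix (Fin N × Fin N) (Fin N × Fin N) 𝕜

/-- The matrix unit `e_{ij}`. -/
def e {N : ℕ} (i j : Fin N) : Matrix (Fin N) (Fin N) K := Matrix.single i j 1

/-- `P = ∑ e_{ij} ⊗ e_{ji}`. -/
def P (N : ℕ) : Mat2 N K := ∑ i, ∑ j, e i j ⊗ₖ e j i

/-- `Q = ∑ q^{ī - j̄} e_{i'j'} ⊗ e_{ij}`. -/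
def Q (N : ℕ) : Mat2 N K :=
  ∑ i : Fin N, ∑ j : Fin N, (qbar i * (qbar j)⁻¹) • (e i.rev j.rev ⊗ₖ e i j)

/-- The constant `R`-matrix. The second sum is `e_{n+1,n+1} ⊗ e_{n+1,n+1}` for `N = 2n+1`
and is empty for even `N`. -/
def R0 (N : ℕ) : Mat2 N K :=
  q • (∑ i : Fin N, if i ≠ i.rev then e i i ⊗ₖ e i i else 0)
  + (∑ i : Fin N, if i = i.rev then e i i ⊗ₖ e i i else 0)
  + (∑ i : Fin N, ∑ j : Fin N, if i ≠ j ∧ i ≠ j.rev then e i i ⊗ₖ e j j else 0)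
  + q⁻¹ • (∑ i : Fin N, if i ≠ i.rev then e i i ⊗ₖ e i.rev i.rev else 0)
  + (q - q⁻¹) • (∑ i : Fin N, ∑ j : Fin N, if i < j then e i j ⊗ₖ e j i else 0)
  - (q - q⁻¹) • (∑ i : Fin N, ∑ j : Fin N,
      if j < i then (qbar i * (qbar j)⁻¹) • (e i.rev j.rev ⊗ₖ e i j) else 0)

/-- The scalar power series `1 / ((1 - u q⁻²)(1 - u q²)(1 - u ξ)(1 - u ξ⁻¹))`. -/
def fRhs (N : ℕ) : K⟦X⟧ :=
  ((1 - PowerSeries.C (q⁻¹ ^ 2) * PowerSeries.X) * (1 - PowerSeries.C (q ^ 2) * PowerSeries.X)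
    * (1 - PowerSeries.C (xi N) * PowerSeries.X)
    * (1 - PowerSeries.C (xi N)⁻¹ * PowerSeries.X))⁻¹

/-- The coefficients of `f`, computed recursively from `f(u) f(uξ) = fRhs`, `f(0) = 1`. -/
def fCoeff (N : ℕ) : ℕ → K
  | 0 => 1
  | k + 1 => (PowerSeries.coeff (k + 1) (fRhs N)
      - ∑ j : Fin k, fCoeff N (j + 1) * (xi N ^ (k - (j : ℕ)) * fCoeff N (k - (j : ℕ))))
        / (1 + xi N ^ (k + 1))
  decreasing_by all_goals omega

/-- The formal power series `f(u)`; see `f_spec`. -/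
def f (N : ℕ) : K⟦X⟧ := PowerSeries.mk (fCoeff N)

/-- `R(u) = f(u) (q⁻¹(u-1)(u-ξ) R - (q⁻²-1)(u-ξ) P + (q⁻²-1)(u-1) ξ Q)` as a matrix of
power series in `u`. -/
def RMat (N : ℕ) : Mat2 N K⟦X⟧ :=
  f N •
    ((PowerSeries.C q⁻¹ * (PowerSeries.X - 1) * (PowerSeries.X - PowerSeries.C (xi N)))
        • (R0 N).map PowerSeries.C
      - (PowerSeries.C (q⁻¹ ^ 2 - 1) * (PowerSeries.X - PowerSeries.C (xi N)))
        • (P N).map PowerSeries.C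
      + (PowerSeries.C (q⁻¹ ^ 2 - 1) * (PowerSeries.X - 1) * PowerSeries.C (xi N))
        • (Q N).map PowerSeries.C)

/-- `R̄(u) = (u-1)/(uq-q⁻¹) R + (q-q⁻¹)/(uq-q⁻¹) P - (q-q⁻¹)(u-1)ξ/((uq-q⁻¹)(u-ξ)) Q`,
expanded as a matrix of power series in `u`. -/
def RBar (N : ℕ) : Mat2 N K⟦X⟧ :=
  ((PowerSeries.X - 1) * (PowerSeries.C q * PowerSeries.X - PowerSeries.C q⁻¹)⁻¹)
      • (R0 N).map PowerSeries.C
    + (PowerSeries.C (q - q⁻¹) * (PowerSeries.C q * PowerSeries.X - PowerSeries.C q⁻¹)⁻¹)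
      • (P N).map PowerSeries.C
    - (PowerSeries.C (q - q⁻¹) * (PowerSeries.X - 1) * PowerSeries.C (xi N)
        * ((PowerSeries.C q * PowerSeries.X - PowerSeries.C q⁻¹)
            * (PowerSeries.X - PowerSeries.C (xi N)))⁻¹)
      • (Q N).map PowerSeries.C

/-! ### The algebras `U(R)` and `U(R̄)` -/

/-- The two signs in `L^±(u)`. -/
inductive Sgn : Type
  | plus
  | minus

/-- The sign as an integer. -/
def Sgn.val : Sgn → ℤ
  | plus => 1
  | minus => -1

/-- The generators: `q^{c/2}`, its inverse, and the coefficients `l^ε_{ij}[-εm]` of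
`u^{εm}` in `l^ε_{ij}(u)`. -/
inductive Gen (N : ℕ) : Type
  | qc : Gen N
  | qcInv : Gen N
  | l (ε : Sgn) (i j : Fin N) (m : ℕ) : Gen N

/-- The shape of the zero modes: `upper` means that `(l⁺_{ij}[0])` is upper triangular and
`(l⁻_{ij}[0])` is lower triangular; `lower` means the opposite. -/
inductive ZeroModes : Type
  | upper
  | lower

/-- The pairs `(i, j)` for which `l⁺_{ij}[0] = l⁻_{ji}[0] = 0` is imposed. -/
def ZeroModes.vanish : ZeroModes → {N : ℕ} → Fin N → Fin N → Prop
  | upper, _, i, j => j < i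
  | lower, _, i, j => i < j

/-- The generator as an element of the free algebra. -/
abbrev gen {N : ℕ} (g : Gen N) : FreeAlgebra K (Gen N) := FreeAlgebra.ι K g

/-- The coefficient of `u^a`, `a ∈ ℤ`, in `l^ε_{ij}(u) = ∑_{m ≥ 0} l^ε_{ij}[-εm] u^{εm}`. -/
def lc {N : ℕ} (ε : Sgn) (i j : Fin N) (a : ℤ) : FreeAlgebra K (Gen N) :=
  if 0 ≤ ε.val * a then gen (Gen.l ε i j (ε.val * a).toNat) else 0

/-- For `𝓡(x) = ∑_t 𝓡_t x^t`, the coefficient of `u^a v^b` in the `((i,j),(k,l))` entry of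
`𝓡(u y / v) L^ε_1(u) L^δ_2(v)`. For `(ε, δ) = (+,+), (-,-), (+,-)` all the terms with
`t > max |a| |b|` vanish, so that the sum is the full (finite) one. -/
def lhsCoeff {N : ℕ} (𝓡 : Mat2 N K⟦X⟧) (y : FreeAlgebra K (Gen N)) (ε δ : Sgn) (a b : ℤ)
    (i j k l : Fin N) : FreeAlgebra K (Gen N) :=
  ∑ t ∈ Finset.range (a.natAbs + b.natAbs + 1), ∑ p : Fin N, ∑ r : Fin N,
    PowerSeries.coeff t (𝓡 (i, j) (p, r)) •
      (y ^ t * (lc ε p k (a - t) * lc δ r l (b + t)))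

/-- The coefficient of `u^a v^b` in the `((i,j),(k,l))` entry of
`L^δ_2(v) L^ε_1(u) 𝓡(u y / v)`. -/
def rhsCoeff {N : ℕ} (𝓡 : Mat2 N K⟦X⟧) (y : FreeAlgebra K (Gen N)) (ε δ : Sgn) (a b : ℤ)
    (i j k l : Fin N) : FreeAlgebra K (Gen N) :=
  ∑ t ∈ Finset.range (a.natAbs + b.natAbs + 1), ∑ p : Fin N, ∑ r : Fin N,
    PowerSeries.coeff t (𝓡 (p, r) (k, l)) •
      ((lc δ j r (b + t) * lc ε i p (a - t)) * y ^ t)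

/-- The defining relations of the algebra associated with the `R`-matrix `𝓡(u)`. -/
inductive Rel {N : ℕ} (𝓡 : Mat2 N K⟦X⟧) (c : ZeroModes) :
    FreeAlgebra K (Gen N) → FreeAlgebra K (Gen N) → Prop
  | qc_mul_inv : Rel 𝓡 c (gen Gen.qc * gen Gen.qcInv) 1
  | inv_mul_qc : Rel 𝓡 c (gen Gen.qcInv * gen Gen.qc) 1
  | qc_central (g : Gen N) : Rel 𝓡 c (gen Gen.qc * gen g) (gen g * gen Gen.qc)
  | zero_plus (i j : Fin N) (h : c.vanish i j) : Rel 𝓡 c (gen (Gen.l .plus i j 0)) 0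
  | zero_minus (i j : Fin N) (h : c.vanish i j) : Rel 𝓡 c (gen (Gen.l .minus j i 0)) 0
  | diag_plus_minus (i : Fin N) :
      Rel 𝓡 c (gen (Gen.l .plus i i 0) * gen (Gen.l .minus i i 0)) 1
  | diag_minus_plus (i : Fin N) :
      Rel 𝓡 c (gen (Gen.l .minus i i 0) * gen (Gen.l .plus i i 0)) 1
  /-- `𝓡(u/v) L^±_1(u) L^±_2(v) = L^±_2(v) L^±_1(u) 𝓡(u/v)`. -/
  | rll_same (ε : Sgn) (a b : ℤ) (i j k l : Fin N) :
      Rel 𝓡 c (lhsCoeff 𝓡 1 ε ε a b i j k l) (rhsCoeff 𝓡 1 ε ε a b i j k l)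
  /-- `𝓡(u q^c/v) L⁺_1(u) L⁻_2(v) = L⁻_2(v) L⁺_1(u) 𝓡(u q^{-c}/v)`. -/
  | rll_mixed (a b : ℤ) (i j k l : Fin N) :
      Rel 𝓡 c (lhsCoeff 𝓡 (gen Gen.qc ^ 2) .plus .minus a b i j k l)
        (rhsCoeff 𝓡 (gen Gen.qcInv ^ 2) .plus .minus a b i j k l)

/-- The algebra associated with the `R`-matrix `𝓡(u)`: this is `U(R)` for `𝓡 = RMat N` and
`U(R̄)` for `𝓡 = RBar N`. -/
abbrev U {N : ℕ} (𝓡 : Mat2 N K⟦X⟧) (c : ZeroModes) : Type := RingQuot (Rel 𝓡 c)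

/-! ### Generator series, Gauss decomposition and the products -/

/-- The matrix `L^ε(u)`, whose entries are power series in `u` for `ε = +` and in `u⁻¹` for
`ε = -`: the coefficient with number `m` is that of `u^{εm}`. -/
def LMat {N : ℕ} (𝓡 : Mat2 N K⟦X⟧) (c : ZeroModes) (ε : Sgn) :
    Matrix (Fin N) (Fin N) (U 𝓡 c)⟦X⟧ :=
  Matrix.of fun i j => PowerSeries.mk fun m =>
    RingQuot.mkAlgHom K (Rel 𝓡 c) (gen (Gen.l ε i j m))

/-- The substitution `g(u) ↦ g(ua)` in a series in `u^{±1}` (with the sign given by `ε`). -/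
def shift {A : Type} [Ring A] [Algebra K A] (ε : Sgn) (a : K) (g : A⟦X⟧) : A⟦X⟧ :=
  PowerSeries.mk fun m => a ^ (ε.val * (m : ℤ)) • PowerSeries.coeff m g

/-- `D = diag[q^{1̄}, …, q^{N̄}]`. -/
def DMat (N : ℕ) (A : Type) [Ring A] [Algebra K A] : Matrix (Fin N) (Fin N) A⟦X⟧ :=
  Matrix.diagonal fun i => PowerSeries.C (algebraMap K A (qbar i))

/-- `D⁻¹`. -/
def DInv (N : ℕ) (A : Type) [Ring A] [Algebra K A] : Matrix (Fin N) (Fin N) A⟦X⟧ :=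
  Matrix.diagonal fun i => PowerSeries.C (algebraMap K A (qbar i)⁻¹)

/-- The transposition `e_{ij}^t = e_{j'i'}` of a matrix. -/
def tr {N : ℕ} {S : Type} (M : Matrix (Fin N) (Fin N) S) : Matrix (Fin N) (Fin N) S :=
  Matrix.of fun i j => M j.rev i.rev

/-- `z(u)` is the series with
`L(u) D L(uξ)^t D⁻¹ = D L(uξ)^t D⁻¹ L(u) = z(u) 1`. -/
def IsZ {N : ℕ} {A : Type} [Ring A] [Algebra K A] (ε : Sgn)
    (L : Matrix (Fin N) (Fin N) A⟦X⟧) (z : A⟦X⟧) : Prop :=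
  L * (DMat N A * tr (L.map (shift ε (xi N))) * DInv N A) = Matrix.diagonal (fun _ => z) ∧
  (DMat N A * tr (L.map (shift ε (xi N))) * DInv N A) * L = Matrix.diagonal (fun _ => z)

/-- The Gauss decomposition `L = F H E` with `F` lower unitriangular, `H = diag[h_1, …, h_N]`
and `E` upper unitriangular. -/
structure IsGauss {N : ℕ} {S : Type} [Ring S] (L F : Matrix (Fin N) (Fin N) S)
    (h : Fin N → S) (E : Matrix (Fin N) (Fin N) S) : Prop where
  F_diag : ∀ i, F i i = 1
  F_lower : ∀ i j, i < j → F i j = 0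
  E_diag : ∀ i, E i i = 1
  E_upper : ∀ i j, j < i → E i j = 0
  eq : L = F * Matrix.diagonal h * E

/-- `∏_{i=1}^n h_i(uξq^{2i})⁻¹ ∏_{i=1}^n h_i(uξq^{2i-2}) · h_{n+1}(u) h_{n+1}(uq)`, with
`ξ = q^{2-N}`, `N = 2n+1`. The factors are multiplied in the order in which they are written,
with `i` increasing; `h_{i+1}` is `h i` for `i = 0, …, N-1`. -/
def zB {A : Type} [Ring A] [Algebra K A] (ε : Sgn) (n : ℕ) (h : Fin (2 * n + 1) → A⟦X⟧) :
    A⟦X⟧ :=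
  (List.ofFn fun i : Fin n => Ring.inverse
      (shift ε (xi (2 * n + 1) * q ^ (2 * ((i : ℕ) + 1))) (h ⟨i, by omega⟩))).prod
  * (List.ofFn fun i : Fin n =>
      shift ε (xi (2 * n + 1) * q ^ (2 * (i : ℕ))) (h ⟨i, by omega⟩)).prod
  * (h ⟨n, by omega⟩ * shift ε q (h ⟨n, by omega⟩))

/-- `∏_{i=1}^{n-1} h_i(uξq^{2i})⁻¹ ∏_{i=1}^{n-1} h_i(uξq^{2i-2}) · h_n(u) h_{n+1}(u)`, with
`ξ = q^{2-N}`, `N = 2n`, `n ≥ 1`. -/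
def zD {A : Type} [Ring A] [Algebra K A] (ε : Sgn) (n : ℕ) (hn : 1 ≤ n)
    (h : Fin (2 * n) → A⟦X⟧) : A⟦X⟧ :=
  (List.ofFn fun i : Fin (n - 1) => Ring.inverse
      (shift ε (xi (2 * n) * q ^ (2 * ((i : ℕ) + 1))) (h ⟨i, by omega⟩))).prod
  * (List.ofFn fun i : Fin (n - 1) =>
      shift ε (xi (2 * n) * q ^ (2 * (i : ℕ))) (h ⟨i, by omega⟩)).prod
  * (h ⟨n - 1, by omega⟩ * h ⟨n, by omega⟩)

/-! ### The defining property of `f` -/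

theorem s_ne_zero : s ≠ 0 := RatFunc.X_ne_zero

theorem s_pow_ne_one (m : ℕ) (hm : m ≠ 0) : s ^ m ≠ 1 := by
  intro h
  have h1 : (algebraMap (Polynomial ℂ) K) (Polynomial.X ^ m) = algebraMap (Polynomial ℂ) K 1 := by
    rw [map_pow, RatFunc.algebraMap_X, map_one]; exact h
  have h2 := RatFunc.algebraMap_injective ℂ h1
  have h3 := congrArg Polynomial.natDegree h2
  rw [Polynomial.natDegree_X_pow, Polynomial.natDegree_one] at h3
  exact hm h3

theorem one_add_xi_pow_ne_zero (N k : ℕ) : 1 + xi N ^ k ≠ 0 := by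
  intro h
  have h1 : s ^ ((2 : ℕ) * (2 - (N : ℤ)) * k) = -1 := by
    have : xi N ^ k = s ^ ((2 : ℕ) * (2 - (N : ℤ)) * k) := by
      rw [xi, q, ← zpow_natCast s 2, ← zpow_mul, ← zpow_natCast, ← zpow_mul]
    rw [← this]; linear_combination h
  set m : ℤ := (2 : ℕ) * (2 - (N : ℤ)) * k with hm
  by_cases h0 : m = 0
  · rw [h0, zpow_zero] at h1
    have : (2 : K) = 0 := by linear_combination h1
    exact two_ne_zero this
  · have h2 : s ^ (m * 2) = 1 := by
      rw [zpow_mul, h1]; norm_num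
    have h3 : s ^ (m * 2).natAbs = 1 := by
      rcases Int.natAbs_eq (m * 2) with h4 | h4
      · rw [h4, zpow_natCast] at h2; exact h2
      · rw [h4, zpow_neg, zpow_natCast, inv_eq_one] at h2; exact h2
    exact s_pow_ne_one _ (by omega) h3

theorem f_zero (N : ℕ) : PowerSeries.constantCoeff (f N) = 1 := by
  rw [f, ← PowerSeries.coeff_zero_eq_constantCoeff_apply, PowerSeries.coeff_mk, fCoeff]

/-- The relation `f(u) f(uξ) = 1 / ((1 - u q⁻²)(1 - u q²)(1 - u ξ)(1 - u ξ⁻¹))`. -/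
theorem f_spec (N : ℕ) : f N * PowerSeries.rescale (xi N) (f N) = fRhs N := by
  ext k
  rw [PowerSeries.coeff_mul, Finset.Nat.sum_antidiagonal_eq_sum_range_succ_mk]
  simp only [PowerSeries.coeff_rescale, f, PowerSeries.coeff_mk]
  cases k with
  | zero => simp [fCoeff, fRhs, PowerSeries.constantCoeff_inv]
  | succ k =>
    rw [Finset.sum_range_succ, Finset.sum_range_succ']
    have hk : fCoeff N (k + 1) * (1 + xi N ^ (k + 1)) = PowerSeries.coeff (k + 1) (fRhs N)
      - ∑ j : Fin k, fCoeff N (j + 1) * (xi N ^ (k - (j : ℕ)) * fCoeff N (k - (j : ℕ))) := by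
      conv_lhs => rw [fCoeff]
      exact div_mul_cancel₀ _ (one_add_xi_pow_ne_zero N (k + 1))
    rw [Fin.sum_univ_eq_sum_range
      (fun j => fCoeff N (j + 1) * (xi N ^ (k - j) * fCoeff N (k - j)))] at hk
    have h0 : fCoeff N 0 = 1 := by rw [fCoeff]
    simp only [Nat.add_sub_add_right, Nat.sub_zero, Nat.sub_self, h0, pow_zero]
    linear_combination hk

end QAffine

end

/-! Up to an invertible scalar series both R-matrices equal one polynomial matrix `RPoly`. Hence the
relations among the entries of a single L(u) = L^±(u) may be evaluated at every nonzero ratio x =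
u/v (`rll_eval`), and special values of x carry the proof.

Existence of z(u): at x = ξ the matrix `RPoly` becomes a multiple of Q, which has rank one, and the
resulting relation says that L(u) and M(u) = D L(uξ)^t D^{-1} multiply to a scalar matrix in either
order (`exists_isZ`). For N = 2 this multiple is zero; after division by x - 1 the relation at x = 1
takes its place.

The formula: in rows i, k and columns j, l with k ≠ i' and l ≠ j', Q and the other terms peculiar to
types B and D disappear, leaving relations of type A (`typeA_LMat`). At x = q^{-2} these say that L
is a q-Manin matrix twisted by u ↦ uq^2, a property inherited by Schur complements
(`Manin.schur_succ`). Reversing the order of rows and columns of M gives `revTr`, a rescaled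
transpose of L(uξ). Gaussian elimination from the top left in both L and `revTr` preserves the
equation ML = z on the surviving indices, and continuing up to the middle leaves a single term: z is
a pivot of `revTr` times a pivot of L (`IsZ.eq_prod`). In a transpose the noncommuting factors of a
Schur complement stand in the wrong order; the Manin relations restore the order at the cost of a
factor h(u) on the left and h(uq^2)^{-1} on the right (`flip_schur_mul`). Iteration produces the two
products (`schur_revTr`).

The order of the factors: pivots of the first half commute at all arguments. Distinct ones do
because a leading block commutes with the Schur complement next to it (`commute_schur_complement`),
equal ones because h_p^{-1} is the corner entry of an inverse block (`commute_piv_self`). For the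
middle pivot of type B, whose commutation with its own shift is not covered by this argument, the
fact that z commutes with all entries of L is used instead. -/

noncomputable section

namespace QAffine

/-! ### Gaussian elimination over a noncommutative ring -/

section Schur

variable {N : ℕ} {S : Type} [Ring S]

/-- The iterated Schur complements: `schur L m` is obtained from `L` by eliminating the first
`m` rows and columns. -/
def schur (L : Matrix (Fin N) (Fin N) S) : ℕ → Matrix (Fin N) (Fin N) S
  | 0 => L
  | m + 1 => if h : m < N then
      Matrix.of fun i j => schur L m i j
        - schur L m i ⟨m, h⟩ * Ring.inverse (schur L m ⟨m, h⟩ ⟨m, h⟩) * schur L m ⟨m, h⟩ j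
    else schur L m

/-- The pivots of Gaussian elimination. -/
def piv (L : Matrix (Fin N) (Fin N) S) (p : Fin N) : S := schur L p p p

theorem schur_zero (L : Matrix (Fin N) (Fin N) S) : schur L 0 = L := rfl

theorem schur_succ (L : Matrix (Fin N) (Fin N) S) (p i j : Fin N) :
    schur L (p + 1) i j
      = schur L p i j - schur L p i p * Ring.inverse (piv L p) * schur L p p j := by
  simp [schur, piv]

theorem schur_row_eq_zero {L : Matrix (Fin N) (Fin N) S} {m : ℕ} (hm : m ≤ N)
    (hL : ∀ p : Fin N, (p : ℕ) < m → IsUnit (piv L p)) (i j : Fin N) (hi : (i : ℕ) < m) :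
    schur L m i j = 0 := by
  induction m generalizing j with
  | zero => omega
  | succ m ih =>
    obtain ⟨p, rfl⟩ : ∃ p : Fin N, (p : ℕ) = m := ⟨⟨m, by omega⟩, rfl⟩
    have ih' := ih (by omega) (fun p' hp => hL p' (by omega))
    rw [schur_succ]
    by_cases h : i = p
    · subst h
      have := Ring.mul_inverse_cancel _ (hL i (by omega))
      rw [← piv, this, one_mul, sub_self]
    · have h2 : (i : ℕ) < p := lt_of_le_of_ne (by omega) (fun h' => h (Fin.ext h'))
      rw [ih' _ h2, ih' _ h2, zero_mul, zero_mul, sub_zero]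

theorem schur_col_eq_zero {L : Matrix (Fin N) (Fin N) S} {m : ℕ} (hm : m ≤ N)
    (hL : ∀ p : Fin N, (p : ℕ) < m → IsUnit (piv L p)) (i j : Fin N) (hj : (j : ℕ) < m) :
    schur L m i j = 0 := by
  induction m generalizing i with
  | zero => omega
  | succ m ih =>
    obtain ⟨p, rfl⟩ : ∃ p : Fin N, (p : ℕ) = m := ⟨⟨m, by omega⟩, rfl⟩
    have ih' := ih (by omega) (fun p' hp => hL p' (by omega))
    rw [schur_succ]
    by_cases h : j = p
    · subst h
      have := Ring.inverse_mul_cancel _ (hL j (by omega))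
      rw [← piv, mul_assoc, this, mul_one, sub_self]
    · have h2 : (j : ℕ) < p := lt_of_le_of_ne (by omega) (fun h' => h (Fin.ext h'))
      rw [ih' _ h2, ih' _ h2, mul_zero, sub_zero]

/-- The lower triangular factor obtained by Gaussian elimination. -/
def gaussF (L : Matrix (Fin N) (Fin N) S) : Matrix (Fin N) (Fin N) S :=
  Matrix.of fun i j => schur L j i j * Ring.inverse (piv L j)

/-- The upper triangular factor obtained by Gaussian elimination. -/
def gaussE (L : Matrix (Fin N) (Fin N) S) : Matrix (Fin N) (Fin N) S :=
  Matrix.of fun i j => Ring.inverse (piv L i) * schur L i i j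

/-- Each elimination step subtracts one term of rank one, so the steps telescope; no invertibility
enters. At m = N the left side is zero once the pivots are units, and this is the Gauss
factorization. -/
theorem schur_eq_sub_sum (L : Matrix (Fin N) (Fin N) S) (m : ℕ) (hm : m ≤ N) (i j : Fin N) :
    schur L m i j = L i j - ∑ k : Fin N, if (k : ℕ) < m then
      schur L k i k * Ring.inverse (piv L k) * schur L k k j else 0 := by
  induction m with
  | zero => simp [schur_zero]
  | succ m ih =>
    obtain ⟨p, rfl⟩ : ∃ p : Fin N, (p : ℕ) = m := ⟨⟨m, by omega⟩, rfl⟩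
    rw [schur_succ, ih (by omega), sub_sub]
    congr 1
    have : ∀ k : Fin N, (if (k : ℕ) < p + 1 then
        schur L k i k * Ring.inverse (piv L k) * schur L k k j else 0)
        = (if (k : ℕ) < p then schur L k i k * Ring.inverse (piv L k) * schur L k k j else 0)
          + if k = p then schur L p i p * Ring.inverse (piv L p) * schur L p p j else 0 := by
      intro k
      by_cases h : k = p
      · subst h; simp
      · have : (k : ℕ) ≠ p := fun h' => h (Fin.ext h')
        have h3 : ((k : ℕ) < p + 1) = ((k : ℕ) < p) := by
          apply propext; omega
        simp [h, h3]
    simp only [this, Finset.sum_add_distrib, Finset.sum_ite_eq', Finset.mem_univ, if_true]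

theorem isGauss_piv {L : Matrix (Fin N) (Fin N) S} (hL : ∀ p, IsUnit (piv L p)) :
    IsGauss L (gaussF L) (piv L) (gaussE L) where
  F_diag i := Ring.mul_inverse_cancel _ (hL i)
  F_lower i j h := by
    rw [gaussF, Matrix.of_apply, schur_row_eq_zero j.is_le' (fun p _ => hL p) i j h, zero_mul]
  E_diag i := Ring.inverse_mul_cancel _ (hL i)
  E_upper i j h := by
    rw [gaussE, Matrix.of_apply, schur_col_eq_zero i.is_le' (fun p _ => hL p) i j h, mul_zero]
  eq := by
    ext i j
    have h := schur_eq_sub_sum L N le_rfl i j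
    rw [schur_row_eq_zero le_rfl (fun p _ => hL p) i j i.2, eq_comm, sub_eq_zero] at h
    rw [h, Matrix.mul_apply]
    refine Finset.sum_congr rfl fun k _ => ?_
    rw [if_pos k.2, Matrix.mul_diagonal, gaussF, gaussE, Matrix.of_apply, Matrix.of_apply,
      Ring.inverse_mul_cancel_right _ _ (hL k), mul_assoc]

/-- Eliminating the k-th row and column removes exactly the k-th term of F H E. After p steps
triangularity leaves h_p E_{pj} in row p and F_{ip} h_p in column p, which is why the factors are
determined by L. -/
theorem IsGauss.schur_eq {L F E : Matrix (Fin N) (Fin N) S} {h : Fin N → S}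
    (hG : IsGauss L F h E) (hL : ∀ p, IsUnit (piv L p)) (m : ℕ) (hm : m ≤ N) (i j : Fin N) :
    schur L m i j = ∑ k : Fin N, if m ≤ (k : ℕ) then F i k * h k * E k j else 0 := by
  induction m generalizing i j with
  | zero =>
    rw [schur_zero, hG.eq, Matrix.mul_apply]
    simp [Matrix.mul_diagonal]
  | succ m ih =>
    obtain ⟨p, rfl⟩ : ∃ p : Fin N, (p : ℕ) = m := ⟨⟨m, by omega⟩, rfl⟩
    have ih' := ih (by omega)
    have hr : ∀ j, schur L p p j = h p * E p j := by
      intro j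
      rw [ih', Finset.sum_eq_single p]
      · simp [hG.F_diag]
      · intro k _ hk
        split_ifs with h1
        · rw [hG.F_lower p k (lt_of_le_of_ne h1 (Ne.symm hk)), zero_mul, zero_mul]
        · rfl
      · simp
    have hc : ∀ i, schur L p i p = F i p * h p := by
      intro i
      rw [ih', Finset.sum_eq_single p]
      · simp [hG.E_diag]
      · intro k _ hk
        split_ifs with h1
        · rw [hG.E_upper k p (lt_of_le_of_ne h1 (Ne.symm hk)), mul_zero]
        · rfl
      · simp
    have hp : piv L p = h p := by rw [piv, hr, hG.E_diag, mul_one]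
    rw [schur_succ, hr, hc, hp, Ring.mul_inverse_cancel_right _ _ (hp ▸ hL p), ih', sub_eq_iff_eq_add,
      ← mul_assoc]
    have : ∀ k : Fin N, (if (p : ℕ) ≤ k then F i k * h k * E k j else 0)
        = (if (p : ℕ) + 1 ≤ k then F i k * h k * E k j else 0)
          + if k = p then F i p * h p * E p j else 0 := by
      intro k
      by_cases h1 : k = p
      · subst h1; simp
      · have h2 : (k : ℕ) ≠ p := fun h' => h1 (Fin.ext h')
        have h3 : ((p : ℕ) + 1 ≤ k) = ((p : ℕ) ≤ k) := by
          apply propext; omega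
        simp only [h1, h3, if_false, add_zero]
    simp only [this, Finset.sum_add_distrib, Finset.sum_ite_eq', Finset.mem_univ, if_true]

/-- The Gauss decomposition is unique. -/
theorem IsGauss.unique {L F E : Matrix (Fin N) (Fin N) S} {h : Fin N → S}
    (hG : IsGauss L F h E) (hL : ∀ p, IsUnit (piv L p)) :
    F = gaussF L ∧ h = piv L ∧ E = gaussE L := by
  have hr : ∀ p j : Fin N, schur L p p j = h p * E p j := by
    intro p j
    rw [hG.schur_eq hL p p.is_le', Finset.sum_eq_single p]
    · simp [hG.F_diag]
    · intro k _ hk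
      split_ifs with h1
      · rw [hG.F_lower p k (lt_of_le_of_ne h1 (Ne.symm hk)), zero_mul, zero_mul]
      · rfl
    · simp
  have hc : ∀ p i : Fin N, schur L p i p = F i p * h p := by
    intro p i
    rw [hG.schur_eq hL p p.is_le', Finset.sum_eq_single p]
    · simp [hG.E_diag]
    · intro k _ hk
      split_ifs with h1
      · rw [hG.E_upper k p (lt_of_le_of_ne h1 (Ne.symm hk)), mul_zero]
      · rfl
    · simp
  have hp : h = piv L := by
    ext p
    rw [piv, hr, hG.E_diag, mul_one]
  refine ⟨?_, hp, ?_⟩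
  · ext i j
    rw [gaussF, Matrix.of_apply, hc, hp, Ring.mul_inverse_cancel_right _ _ (hL j)]
  · ext i j
    rw [gaussE, Matrix.of_apply, hr, hp, Ring.inverse_mul_cancel_left _ _ (hL i)]

end Schur

/-! ### Pivots of a matrix with triangular constant term -/

section Units

variable {N : ℕ} {A : Type} [Ring A]

/-- A power series is a unit as soon as its constant term is. In the correction S_{ip} h_p^{-1}
S_{pj} with i, j > p one outer factor lies in the triangle where constant terms vanish, so
elimination changes neither that triangle nor the constant terms on the remaining diagonal. -/
theorem isUnit_piv_of_triangular (c : ZeroModes) {L : Matrix (Fin N) (Fin N) A⟦X⟧}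
    (ht : (∀ i j, c.vanish i j → PowerSeries.constantCoeff (L i j) = 0) ∨
      (∀ i j, c.vanish i j → PowerSeries.constantCoeff (L j i) = 0))
    (hd : ∀ i, IsUnit (PowerSeries.constantCoeff (L i i))) (p : Fin N) : IsUnit (piv L p) := by
  -- L^- has the opposite triangular shape to L^+; replacing the convention by its opposite treats
  -- both at once.
  obtain ⟨c', hc'⟩ : ∃ c' : ZeroModes,
      ∀ i j : Fin N, c'.vanish i j → PowerSeries.constantCoeff (L i j) = 0 := by
    rcases ht with ht | ht
    · exact ⟨c, ht⟩
    · cases c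
      · exact ⟨.lower, fun i j h => ht j i h⟩
      · exact ⟨.upper, fun i j h => ht j i h⟩
  have key : ∀ m ≤ N, (∀ p : Fin N, (p : ℕ) < m → IsUnit (piv L p)) ∧
      (∀ i j, c'.vanish i j → PowerSeries.constantCoeff (schur L m i j) = 0) ∧
      (∀ i : Fin N, m ≤ i → PowerSeries.constantCoeff (schur L m i i)
        = PowerSeries.constantCoeff (L i i)) := by
    intro m hm
    induction m with
    | zero => exact ⟨by simp, hc', fun i _ => rfl⟩
    | succ m ih =>
      obtain ⟨p, rfl⟩ : ∃ p : Fin N, (p : ℕ) = m := ⟨⟨m, by omega⟩, rfl⟩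
      obtain ⟨hu, hv, hdd⟩ := ih (by omega)
      have hp : IsUnit (piv L p) := by
        rw [PowerSeries.isUnit_iff_constantCoeff, piv, hdd p le_rfl]
        exact hd p
      have hz : ∀ i j : Fin N, (p : ℕ) + 1 ≤ i ∧ (p : ℕ) + 1 ≤ j → c'.vanish i j ∨ i = j →
          PowerSeries.constantCoeff (schur L p i p) = 0 ∨
          PowerSeries.constantCoeff (schur L p p j) = 0 := by
        rintro i j ⟨hi, hj⟩ _
        cases c'
        · exact Or.inl (hv _ _ (show p < i from hi))
        · exact Or.inr (hv _ _ (show p < j from hj))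
      have hu' : ∀ p' : Fin N, (p' : ℕ) < p + 1 → IsUnit (piv L p') := by
        intro p' hp'
        by_cases h : p' = p
        · exact h ▸ hp
        · exact hu p' (lt_of_le_of_ne (by omega) (fun h' => h (Fin.ext h')))
      refine ⟨hu', fun i j hij => ?_, fun i hi => ?_⟩
      · by_cases hi : (p : ℕ) + 1 ≤ i
        · by_cases hj : (p : ℕ) + 1 ≤ j
          · rw [schur_succ, map_sub, map_mul, map_mul, hv i j hij]
            rcases hz i j ⟨hi, hj⟩ (Or.inl hij) with h | h <;> simp [h]
          · rw [schur_col_eq_zero hm hu' i j (by omega), map_zero]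
        · rw [schur_row_eq_zero hm hu' i j (by omega), map_zero]
      · rw [schur_succ, map_sub, map_mul, map_mul, hdd i (by omega)]
        rcases hz i i ⟨hi, hi⟩ (Or.inr rfl) with h | h <;> simp [h]
  exact (key N le_rfl).1 p p.2

end Units

/-! ### The substitutions `g(u) ↦ g(ua)` -/

section Shift

variable {A : Type} [Ring A] [Algebra K A]

theorem coeff_shift (ε : Sgn) (a : K) (g : A⟦X⟧) (m : ℕ) :
    PowerSeries.coeff m (shift ε a g) = a ^ (ε.val * (m : ℤ)) • PowerSeries.coeff m g := by
  rw [shift, PowerSeries.coeff_mk]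

theorem coeff_K_smul (m : ℕ) (a : K) (g : A⟦X⟧) :
    PowerSeries.coeff m (a • g) = a • PowerSeries.coeff m g := rfl

theorem shift_algebraMap (ε : Sgn) (a r : K) :
    shift ε a (algebraMap K A⟦X⟧ r) = algebraMap K A⟦X⟧ r := by
  ext m
  rw [coeff_shift, Algebra.algebraMap_eq_smul_one, coeff_K_smul, PowerSeries.coeff_one]
  split_ifs with h
  · simp [h]
  · simp

theorem shift_mul (ε : Sgn) {a : K} (ha : a ≠ 0) (f g : A⟦X⟧) :
    shift ε a (f * g) = shift ε a f * shift ε a g := by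
  ext m
  rw [coeff_shift, PowerSeries.coeff_mul, PowerSeries.coeff_mul, Finset.smul_sum]
  refine Finset.sum_congr rfl fun p hp => ?_
  rw [coeff_shift, coeff_shift, smul_mul_smul_comm, ← zpow_add₀ ha, ← Finset.HasAntidiagonal.mem_antidiagonal.1 hp]
  congr 2
  push_cast
  ring

/-- The substitution `g(u) ↦ g(ua)` as an algebra homomorphism. -/
def shiftHom (ε : Sgn) (a : K) (ha : a ≠ 0) : A⟦X⟧ →ₐ[K] A⟦X⟧ where
  toFun := shift ε a
  map_one' := by simpa using shift_algebraMap (A := A) ε a 1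
  map_mul' := shift_mul ε ha
  map_zero' := by ext m; simp [coeff_shift]
  map_add' f g := by ext m; simp [coeff_shift]
  commutes' := shift_algebraMap ε a

theorem shiftHom_apply (ε : Sgn) (a : K) (ha : a ≠ 0) (g : A⟦X⟧) :
    shiftHom ε a ha g = shift ε a g := rfl

theorem shift_shift (ε : Sgn) (a b : K) (g : A⟦X⟧) :
    shift ε a (shift ε b g) = shift ε (a * b) g := by
  ext m
  rw [coeff_shift, coeff_shift, coeff_shift, smul_smul, mul_zpow]

theorem shift_one (ε : Sgn) (g : A⟦X⟧) : shift ε 1 g = g := by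
  ext m
  rw [coeff_shift, one_zpow, one_smul]

theorem shift_injective (ε : Sgn) {a : K} (ha : a ≠ 0) :
    Function.Injective (shift ε a : A⟦X⟧ → A⟦X⟧) := by
  intro f g h
  have := congrArg (shift ε a⁻¹) h
  rwa [shift_shift, shift_shift, inv_mul_cancel₀ ha, shift_one, shift_one] at this

theorem isUnit_shift (ε : Sgn) {a : K} (ha : a ≠ 0) {g : A⟦X⟧} (hg : IsUnit g) :
    IsUnit (shift ε a g) := hg.map (shiftHom ε a ha)

theorem shift_inverse (ε : Sgn) {a : K} (ha : a ≠ 0) {g : A⟦X⟧} (hg : IsUnit g) :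
    shift ε a (Ring.inverse g) = Ring.inverse (shift ε a g) := by
  have h := isUnit_shift ε ha hg
  rw [← mul_one (shift ε a (Ring.inverse g)), ← Ring.mul_inverse_cancel _ h, ← mul_assoc,
    ← shift_mul ε ha, Ring.inverse_mul_cancel _ hg, ← shiftHom_apply ε a ha 1, map_one, one_mul]

/-- A polynomial with coefficients in a vector space over an infinite field that vanishes at all
points outside of a finite set has zero coefficients. -/
theorem coeff_eq_zero_of_sum_pow_smul_eq_zero {k V : Type*} [Field k] [Infinite k] [AddCommGroup V]
    [Module k V] (d : ℕ) (v : ℕ → V) (s : Set k) (hs : s.Finite)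
    (h : ∀ x ∉ s, ∑ i ∈ Finset.range d, x ^ i • v i = 0) (i : ℕ) (hi : i < d) : v i = 0 := by
  rw [← Module.forall_dual_apply_eq_zero_iff k]
  intro φ
  set p : Polynomial k := ∑ i ∈ Finset.range d, Polynomial.monomial i (φ (v i)) with hp
  have hp0 : p = 0 := by
    apply Polynomial.eq_zero_of_infinite_isRoot
    refine (hs.infinite_compl).mono fun x hx => ?_
    have := congrArg φ (h x hx)
    rw [map_sum, map_zero] at this
    simp only [map_smul, smul_eq_mul] at this
    rw [Set.mem_ofPred_eq, Polynomial.IsRoot.def, hp, Polynomial.eval_finsetSum]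
    simpa [Polynomial.eval_monomial, mul_comm] using this
  have := congrArg (fun p => Polynomial.coeff p i) hp0
  simpa [hp, Polynomial.finsetSum_coeff, Polynomial.coeff_monomial, hi] using this

/-- If `f(u)` commutes with `g(xu)` for almost all `x`, then all the coefficients commute. -/
theorem commute_coeff_of_commute_shift (ε : Sgn) {f g : A⟦X⟧} (s : Set K) (hs : s.Finite)
    (h : ∀ x : K, x ≠ 0 → x ∉ s → Commute f (shift ε x⁻¹ g)) (m k : ℕ) :
    Commute (PowerSeries.coeff m f) (PowerSeries.coeff k g) := by
  have key : ∀ x : K, x ≠ 0 → x ∉ s → ∑ i ∈ Finset.range (m + k + 1), (x ^ (-ε.val)) ^ i •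
      (PowerSeries.coeff (m + k - i) f * PowerSeries.coeff i g
        - PowerSeries.coeff i g * PowerSeries.coeff (m + k - i) f) = 0 := by
    intro x hx0 hxs
    have h1 := congrArg (PowerSeries.coeff (m + k)) (h x hx0 hxs).eq
    rw [← sub_eq_zero, PowerSeries.coeff_mul, PowerSeries.coeff_mul,
      ← Finset.Nat.sum_antidiagonal_swap, ← Finset.sum_sub_distrib,
      Finset.Nat.sum_antidiagonal_eq_sum_range_succ_mk] at h1
    rw [← h1]
    refine Finset.sum_congr rfl fun i _ => ?_
    simp only [Prod.swap_prod_mk, coeff_shift, mul_smul_comm, smul_mul_assoc, ← smul_sub]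
    rw [inv_zpow', ← zpow_natCast, ← zpow_mul, neg_mul]
  have := coeff_eq_zero_of_sum_pow_smul_eq_zero (k := K) (m + k + 1)
    (fun i => PowerSeries.coeff (m + k - i) f * PowerSeries.coeff i g
        - PowerSeries.coeff i g * PowerSeries.coeff (m + k - i) f)
    ({0} ∪ s ∪ (fun x => x⁻¹) '' s) (((Set.finite_singleton 0).union hs).union (hs.image _))
    (fun x hx => ?_) k (by omega)
  · rw [Nat.add_sub_cancel, sub_eq_zero] at this
    exact this
  · simp only [Set.mem_union, Set.mem_singleton_iff, Set.mem_image, not_or, not_exists] at hx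
    obtain ⟨⟨hx0, hxs⟩, hxi⟩ := hx
    cases ε
    · simpa [Sgn.val] using key x⁻¹ (inv_ne_zero hx0) (fun h' => hxi x⁻¹ ⟨h', inv_inv x⟩)
    · simpa [Sgn.val] using key x hx0 hxs

theorem commute_shift_of_commute_coeff (ε : Sgn) {f g : A⟦X⟧}
    (h : ∀ m k, Commute (PowerSeries.coeff m f) (PowerSeries.coeff k g)) (a b : K) :
    Commute (shift ε a f) (shift ε b g) := by
  ext m
  rw [PowerSeries.coeff_mul, PowerSeries.coeff_mul, ← Finset.Nat.sum_antidiagonal_swap]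
  refine Finset.sum_congr rfl fun p _ => ?_
  simp only [Prod.fst_swap, Prod.snd_swap, coeff_shift, smul_mul_smul_comm, (h _ _).eq]
  rw [mul_comm]

end Shift

/-! ### Evaluation of the defining relations at scalars -/

section Transfer

/-- In a fixed total degree the products of generators form polynomials in x. The hypothesis is then
an identity of power series in which both sides carry the factor g; cancelling this unit leaves an
identity of polynomials, which can be evaluated at any point. Linear functionals reduce V to the
scalars. -/
theorem eval_relation {k V ι : Type*} [Field k] [AddCommGroup V] [Module k V] [Fintype ι]
    {g : k⟦X⟧} (hg : IsUnit g) (ρ ρ' : ι → Polynomial k) (γ γ' : ι → ℕ → V) (d : ℕ)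
    (hγ : ∀ c m, d < m → γ c m = 0) (hγ' : ∀ c m, d < m → γ' c m = 0)
    (h : ∀ m, ∑ t ∈ Finset.range (m + 1), ∑ c, PowerSeries.coeff t (g * (ρ c : k⟦X⟧)) • γ c (m - t)
      = ∑ t ∈ Finset.range (m + 1), ∑ c, PowerSeries.coeff t (g * (ρ' c : k⟦X⟧)) • γ' c (m - t))
    (x : k) :
    ∑ c, (ρ c).eval x • ∑ m ∈ Finset.range (d + 1), x ^ m • γ c m
      = ∑ c, (ρ' c).eval x • ∑ m ∈ Finset.range (d + 1), x ^ m • γ' c m := by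
  rw [← sub_eq_zero, ← Module.forall_dual_apply_eq_zero_iff k]
  intro φ
  rw [map_sub, sub_eq_zero]
  have main : ∀ (ρ : ι → Polynomial k) (γ : ι → ℕ → V), (∀ c m, d < m → γ c m = 0) →
      ∃ G : ι → Polynomial k, (∀ m, φ (∑ t ∈ Finset.range (m + 1),
          ∑ c, PowerSeries.coeff t (g * (ρ c : k⟦X⟧)) • γ c (m - t))
        = PowerSeries.coeff m (g * ((∑ c, ρ c * G c : Polynomial k) : k⟦X⟧))) ∧
      φ (∑ c, (ρ c).eval x • ∑ m ∈ Finset.range (d + 1), x ^ m • γ c m)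
        = (∑ c, ρ c * G c).eval x := by
    intro ρ γ hγ
    refine ⟨fun c => ∑ m ∈ Finset.range (d + 1), Polynomial.monomial m (φ (γ c m)), fun m => ?_, ?_⟩
    · have hG : ∀ c m, (∑ m ∈ Finset.range (d + 1), Polynomial.monomial m (φ (γ c m))).coeff m
          = φ (γ c m) := by
        intro c m
        rw [Polynomial.finsetSum_coeff]
        simp only [Polynomial.coeff_monomial, Finset.sum_ite_eq', Finset.mem_range]
        split_ifs with hm
        · rfl
        · rw [hγ c m (by omega), map_zero]
      rw [← Polynomial.coeToPowerSeries.ringHom_apply,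
        map_sum Polynomial.coeToPowerSeries.ringHom, Finset.mul_sum, map_sum, map_sum]
      simp only [map_sum]
      rw [Finset.sum_comm]
      refine Finset.sum_congr rfl fun c _ => ?_
      rw [map_mul Polynomial.coeToPowerSeries.ringHom, ← mul_assoc, PowerSeries.coeff_mul,
        Finset.Nat.sum_antidiagonal_eq_sum_range_succ_mk]
      refine Finset.sum_congr rfl fun t _ => ?_
      rw [Polynomial.coeToPowerSeries.ringHom_apply,
        Polynomial.coeToPowerSeries.ringHom_apply, Polynomial.coeff_coe, hG, map_smul, smul_eq_mul]
    · rw [map_sum, Polynomial.eval_finsetSum]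
      refine Finset.sum_congr rfl fun c _ => ?_
      rw [map_smul, map_sum, Polynomial.eval_mul, Polynomial.eval_finsetSum, smul_eq_mul]
      congr 1
      refine Finset.sum_congr rfl fun m _ => ?_
      rw [map_smul, Polynomial.eval_monomial, smul_eq_mul, mul_comm]
  obtain ⟨G, hG1, hG2⟩ := main ρ γ hγ
  obtain ⟨G', hG1', hG2'⟩ := main ρ' γ' hγ'
  rw [hG2, hG2']
  congr 1
  apply Polynomial.coe_injective
  apply hg.mul_left_cancel
  ext m
  rw [← hG1, ← hG1', h]

variable {N : ℕ} {𝓡 : Mat2 N K⟦X⟧} {c : ZeroModes}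

/-- The coefficient of `u^a` in `l^ε_{ij}(u)`. -/
def lcoef (𝓡 : Mat2 N K⟦X⟧) (c : ZeroModes) (ε : Sgn) (i j : Fin N) (a : ℤ) : U 𝓡 c :=
  RingQuot.mkAlgHom K (Rel 𝓡 c) (lc ε i j a)

theorem lcoef_of_nonneg (ε : Sgn) (i j : Fin N) (a : ℤ) (m : ℕ) (h : ε.val * a = m) :
    lcoef 𝓡 c ε i j a = PowerSeries.coeff m (LMat 𝓡 c ε i j) := by
  rw [lcoef, lc, if_pos (by omega), LMat, Matrix.of_apply, PowerSeries.coeff_mk]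
  congr 3
  omega

theorem lcoef_of_neg (ε : Sgn) (i j : Fin N) (a : ℤ) (h : ε.val * a < 0) :
    lcoef 𝓡 c ε i j a = 0 := by
  rw [lcoef, lc, if_neg (by omega), map_zero]

/-- The defining relation sums over a deliberately generous range of t. Here the range is cut to the
terms that can be nonzero, which gives the convolution expected by `eval_relation`. -/
theorem rll_lcoef (ε : Sgn) (a b : ℤ) (i j k l : Fin N) (n : ℕ) (hn : n ≤ a.natAbs + b.natAbs)
    (hz : ∀ t : ℕ, n < t → ε.val * (a - t) < 0 ∨ ε.val * (b + t) < 0) :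
    ∑ t ∈ Finset.range (n + 1), ∑ y : Fin N × Fin N, PowerSeries.coeff t (𝓡 (i, j) y) •
        (lcoef 𝓡 c ε y.1 k (a - t) * lcoef 𝓡 c ε y.2 l (b + t))
      = ∑ t ∈ Finset.range (n + 1), ∑ y : Fin N × Fin N, PowerSeries.coeff t (𝓡 y (k, l)) •
        (lcoef 𝓡 c ε j y.2 (b + t) * lcoef 𝓡 c ε i y.1 (a - t)) := by
  have h := RingQuot.mkAlgHom_rel K (Rel.rll_same (𝓡 := 𝓡) (c := c) ε a b i j k l)
  simp only [lhsCoeff, rhsCoeff, map_sum, map_smul, map_mul, one_pow, one_mul, mul_one] at h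
  have hs : Finset.range (n + 1) ⊆ Finset.range (a.natAbs + b.natAbs + 1) :=
    Finset.range_subset_range.2 (by omega)
  simp only [Fintype.sum_prod_type]
  rw [Finset.sum_subset hs, Finset.sum_subset hs]
  · exact h
  · intro t _ ht
    rw [Finset.mem_range] at ht
    refine Finset.sum_eq_zero fun p _ => Finset.sum_eq_zero fun r _ => ?_
    rcases hz t (by omega) with h' | h' <;> rw [lcoef_of_neg (h := h')] <;> simp
  · intro t _ ht
    rw [Finset.mem_range] at ht
    refine Finset.sum_eq_zero fun p _ => Finset.sum_eq_zero fun r _ => ?_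
    rcases hz t (by omega) with h' | h' <;> rw [lcoef_of_neg (h := h')] <;> simp

/-- The exponent of `u` in the first of the terms of degree `d`. -/
def Sgn.base (d : ℕ) : Sgn → ℤ
  | plus => 0
  | minus => -d

/-- Indexing by the exponent of u, counted from its least value `ε.base d`, makes the coefficient a
polynomial in x up to a power of x. The same power occurs for the opposite order of factors in
`coeff_shift_mul`, so it cancels in `rll_eval`. -/
theorem coeff_mul_shift (ε : Sgn) (x : K) (hx : x ≠ 0) (i j k l : Fin N) (d : ℕ) :
    PowerSeries.coeff d (LMat 𝓡 c ε i k * shift ε x⁻¹ (LMat 𝓡 c ε j l))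
      = x ^ (-(ε.val * d - ε.base d)) • ∑ m ∈ Finset.range (d + 1), x ^ m •
        (lcoef 𝓡 c ε i k (ε.base d + m) * lcoef 𝓡 c ε j l (ε.val * d - (ε.base d + m))) := by
  rw [PowerSeries.coeff_mul, Finset.smul_sum]
  cases ε
  · rw [Finset.Nat.sum_antidiagonal_eq_sum_range_succ_mk]
    refine Finset.sum_congr rfl fun m hm => ?_
    have hm' : m ≤ d := by simpa [Nat.lt_succ_iff] using hm
    rw [coeff_shift, mul_smul_comm, smul_smul, lcoef_of_nonneg (m := m), lcoef_of_nonneg (m := d - m),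
      inv_zpow', ← zpow_natCast x m, ← zpow_add₀ hx]
    · congr 2
      simp only [Sgn.val, Sgn.base]
      push_cast [Nat.cast_sub hm']
      ring
    · simp only [Sgn.val, Sgn.base]
      omega
    · simp only [Sgn.val, Sgn.base]
      omega
  · rw [← Finset.Nat.sum_antidiagonal_swap, Finset.Nat.sum_antidiagonal_eq_sum_range_succ_mk]
    refine Finset.sum_congr rfl fun m hm => ?_
    have hm' : m ≤ d := by simpa [Nat.lt_succ_iff] using hm
    rw [coeff_shift, mul_smul_comm, smul_smul, lcoef_of_nonneg (m := d - m), lcoef_of_nonneg (m := m),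
      inv_zpow', ← zpow_natCast x m, ← zpow_add₀ hx]
    · congr 2
      simp only [Sgn.val, Sgn.base, Prod.snd_swap]
      ring
    · simp only [Sgn.val, Sgn.base]
      omega
    · simp only [Sgn.val, Sgn.base]
      omega

theorem coeff_shift_mul (ε : Sgn) (x : K) (hx : x ≠ 0) (i j k l : Fin N) (d : ℕ) :
    PowerSeries.coeff d (shift ε x⁻¹ (LMat 𝓡 c ε j l) * LMat 𝓡 c ε i k)
      = x ^ (-(ε.val * d - ε.base d)) • ∑ m ∈ Finset.range (d + 1), x ^ m •
        (lcoef 𝓡 c ε j l (ε.val * d - (ε.base d + m)) * lcoef 𝓡 c ε i k (ε.base d + m)) := by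
  rw [PowerSeries.coeff_mul, Finset.smul_sum]
  cases ε
  · rw [← Finset.Nat.sum_antidiagonal_swap, Finset.Nat.sum_antidiagonal_eq_sum_range_succ_mk]
    refine Finset.sum_congr rfl fun m hm => ?_
    have hm' : m ≤ d := by simpa [Nat.lt_succ_iff] using hm
    rw [coeff_shift, smul_mul_assoc, smul_smul, lcoef_of_nonneg (m := d - m), lcoef_of_nonneg (m := m),
      inv_zpow', ← zpow_natCast x m, ← zpow_add₀ hx]
    · congr 2
      simp only [Sgn.val, Sgn.base, Prod.fst_swap]
      push_cast [Nat.cast_sub hm']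
      ring
    · simp only [Sgn.val, Sgn.base]
      omega
    · simp only [Sgn.val, Sgn.base]
      omega
  · rw [Finset.Nat.sum_antidiagonal_eq_sum_range_succ_mk]
    refine Finset.sum_congr rfl fun m hm => ?_
    have hm' : m ≤ d := by simpa [Nat.lt_succ_iff] using hm
    rw [coeff_shift, smul_mul_assoc, smul_smul, lcoef_of_nonneg (m := m), lcoef_of_nonneg (m := d - m),
      inv_zpow', ← zpow_natCast x m, ← zpow_add₀ hx]
    · congr 2
      simp only [Sgn.val, Sgn.base]
      ring
    · simp only [Sgn.val, Sgn.base]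
      omega
    · simp only [Sgn.val, Sgn.base]
      omega

/-- If the row `(i, j)` and the column `(k, l)` of `𝓡(x)` are polynomial up to a common factor,
then the corresponding defining relation may be evaluated at any nonzero `x = u/v`. -/
theorem rll_eval (ε : Sgn) {g : K⟦X⟧} (hg : IsUnit g) (i j k l : Fin N)
    (ρ ρ' : Fin N × Fin N → Polynomial K) (hρ : ∀ y, 𝓡 (i, j) y = g * (ρ y : K⟦X⟧))
    (hρ' : ∀ y, 𝓡 y (k, l) = g * (ρ' y : K⟦X⟧)) (x : K) (hx : x ≠ 0) :
    ∑ y : Fin N × Fin N, (ρ y).eval x •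
        (LMat 𝓡 c ε y.1 k * shift ε x⁻¹ (LMat 𝓡 c ε y.2 l))
      = ∑ y : Fin N × Fin N, (ρ' y).eval x •
        (shift ε x⁻¹ (LMat 𝓡 c ε j y.2) * LMat 𝓡 c ε i y.1) := by
  ext d
  simp only [map_sum, coeff_K_smul, coeff_mul_shift ε x hx, coeff_shift_mul ε x hx]
  simp only [smul_comm _ (x ^ (-(ε.val * d - ε.base d)))]
  rw [← Finset.smul_sum, ← Finset.smul_sum]
  congr 1
  refine eval_relation hg ρ ρ'
    (fun y m => lcoef 𝓡 c ε y.1 k (ε.base d + m) * lcoef 𝓡 c ε y.2 l (ε.val * d - (ε.base d + m)))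
    (fun y m => lcoef 𝓡 c ε j y.2 (ε.val * d - (ε.base d + m)) * lcoef 𝓡 c ε i y.1 (ε.base d + m))
    d ?_ ?_ ?_ x
  · intro y m hm
    cases ε
    · rw [lcoef_of_neg (a := Sgn.plus.val * d - _), mul_zero]
      simp only [Sgn.val, Sgn.base]; omega
    · rw [lcoef_of_neg (a := Sgn.minus.base d + _), zero_mul]
      simp only [Sgn.val, Sgn.base]; omega
  · intro y m hm
    cases ε
    · rw [lcoef_of_neg (a := Sgn.plus.val * d - _), zero_mul]
      simp only [Sgn.val, Sgn.base]; omega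
    · rw [lcoef_of_neg (a := Sgn.minus.base d + _), mul_zero]
      simp only [Sgn.val, Sgn.base]; omega
  · intro m
    have h := rll_lcoef (𝓡 := 𝓡) (c := c) ε (ε.base d + m) (ε.val * d - (ε.base d + m)) i j k l m
      (by cases ε <;> simp only [Sgn.val, Sgn.base] <;> omega)
      (by intro t ht; cases ε <;> simp only [Sgn.val, Sgn.base] <;> omega)
    convert h using 1
    · refine Finset.sum_congr rfl fun t ht => Finset.sum_congr rfl fun y _ => ?_
      have ht' : t ≤ m := by simpa [Nat.lt_succ_iff] using ht
      rw [hρ, Nat.cast_sub ht']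
      congr 3 <;> ring
    · refine Finset.sum_congr rfl fun t ht => Finset.sum_congr rfl fun y _ => ?_
      have ht' : t ≤ m := by simpa [Nat.lt_succ_iff] using ht
      rw [hρ', Nat.cast_sub ht']
      congr 3 <;> ring

end Transfer

/-! ### The entries of the `R`-matrices -/

section Entries

variable {N : ℕ}

theorem q_ne_zero : q ≠ 0 := pow_ne_zero 2 s_ne_zero

theorem q_zpow_ne_one {m : ℤ} (hm : m ≠ 0) : q ^ m ≠ 1 := by
  intro h
  have h3 : s ^ (2 * m).natAbs = 1 := by
    have h2 : s ^ (2 * m) = 1 := by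
      rw [zpow_mul]; exact_mod_cast h
    rcases Int.natAbs_eq (2 * m) with h4 | h4
    · rw [h4, zpow_natCast] at h2; exact h2
    · rw [h4, zpow_neg, zpow_natCast, inv_eq_one] at h2; exact h2
  exact s_pow_ne_one _ (by omega) h3

theorem q_sub_inv_ne_zero : q - q⁻¹ ≠ 0 := by
  intro h
  apply q_zpow_ne_one (m := 2) (by norm_num)
  have := q_ne_zero
  field_simp at h
  rw [mul_zero, sub_eq_zero] at h
  exact_mod_cast h

theorem xi_ne_zero (N : ℕ) : xi N ≠ 0 := zpow_ne_zero _ q_ne_zero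

theorem qbar_ne_zero (i : Fin N) : qbar i ≠ 0 := zpow_ne_zero _ s_ne_zero

theorem qbar_rev (i : Fin N) : qbar i.rev = (qbar i)⁻¹ := by
  rw [qbar, qbar, ← zpow_neg]
  congr 1
  have := i.2
  simp only [bar2, Fin.rev_rev, Fin.lt_def, Fin.ext_iff, Fin.val_rev]
  split_ifs <;> omega

theorem P_apply (y z : Fin N × Fin N) :
    P N y z = if z = (y.2, y.1) then 1 else 0 := by
  obtain ⟨a, b⟩ := y
  obtain ⟨c, d⟩ := z
  simp only [P, e, Matrix.sum_apply, Matrix.kroneckerMap_apply, Matrix.single_apply, Prod.mk.injEq,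
    mul_ite, mul_one, mul_zero, ite_and]
  simp only [Finset.sum_ite_eq', Finset.mem_univ, if_true]
  grind

theorem Q_apply (y z : Fin N × Fin N) :
    Q N y z = if y.1 = y.2.rev ∧ z.1 = z.2.rev then qbar y.2 * (qbar z.2)⁻¹ else 0 := by
  obtain ⟨a, b⟩ := y
  obtain ⟨c, d⟩ := z
  simp only [Q, e, Matrix.sum_apply, Matrix.smul_apply, Matrix.kroneckerMap_apply,
    Matrix.single_apply, smul_eq_mul, mul_ite, mul_one, mul_zero, ite_and]
  simp [eq_comm]

theorem R0_apply (y z : Fin N × Fin N) :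
    R0 N y z = (if z = y then
        (if y.1 = y.2 then (if y.1 = y.1.rev then 1 else q)
          else if y.1 = y.2.rev then q⁻¹ else 1) else 0)
      + (if z = (y.2, y.1) ∧ y.1 < y.2 then q - q⁻¹ else 0)
      - (if y.1 = y.2.rev ∧ z.1 = z.2.rev ∧ z.2 < y.2 then
          (q - q⁻¹) * (qbar y.2 * (qbar z.2)⁻¹) else 0) := by
  obtain ⟨a, b⟩ := y
  obtain ⟨c, d⟩ := z
  have h1 : ∀ (p : Fin N → Prop) [DecidablePred p],
      (∑ i : Fin N, if p i then (e i i ⊗ₖ e i i : Mat2 N K) else 0) (a, b) (c, d)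
      = if a = b ∧ a = c ∧ a = d ∧ p a then 1 else 0 := by
    intro p _
    simp only [e, Matrix.sum_apply, Matrix.ite_apply, Matrix.zero_apply, Matrix.kroneckerMap_apply,
      Matrix.single_apply, mul_ite, mul_one, mul_zero, ite_and]
    rw [Finset.sum_eq_single a]
    · grind
    · intro i _ hi
      grind
    · simp
  have h2 : (∑ i : Fin N, ∑ j : Fin N, if i ≠ j ∧ i ≠ j.rev then (e i i ⊗ₖ e j j : Mat2 N K) else 0)
      (a, b) (c, d) = if a = c ∧ b = d ∧ a ≠ b ∧ a ≠ b.rev then 1 else 0 := by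
    simp only [e, Matrix.sum_apply, Matrix.ite_apply, Matrix.zero_apply, Matrix.kroneckerMap_apply,
      Matrix.single_apply, mul_ite, mul_one, mul_zero]
    rw [Finset.sum_eq_single a, Finset.sum_eq_single b]
    · grind
    · intro i _ hi
      grind
    · simp
    · intro i _ hi
      refine Finset.sum_eq_zero fun j _ => ?_
      grind
    · simp
  have h3 : (∑ i : Fin N, if i ≠ i.rev then (e i i ⊗ₖ e i.rev i.rev : Mat2 N K) else 0)
      (a, b) (c, d) = if a = c ∧ b = d ∧ a = b.rev ∧ a ≠ b then 1 else 0 := by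
    simp only [e, Matrix.sum_apply, Matrix.ite_apply, Matrix.zero_apply, Matrix.kroneckerMap_apply,
      Matrix.single_apply, mul_ite, mul_one, mul_zero]
    rw [Finset.sum_eq_single a]
    · by_cases hb : b = a.rev
      · subst hb
        simp only [Fin.rev_rev]
        grind
      · have hb' : a ≠ b.rev := fun h => hb (by rw [h, Fin.rev_rev])
        grind
    · intro i _ hi
      grind
    · simp
  have h4 : (∑ i : Fin N, ∑ j : Fin N, if i < j then (e i j ⊗ₖ e j i : Mat2 N K) else 0)
      (a, b) (c, d) = if c = b ∧ d = a ∧ a < b then 1 else 0 := by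
    simp only [e, Matrix.sum_apply, Matrix.ite_apply, Matrix.zero_apply, Matrix.kroneckerMap_apply,
      Matrix.single_apply, mul_ite, mul_one, mul_zero]
    rw [Finset.sum_eq_single a, Finset.sum_eq_single b]
    · grind
    · intro i _ hi
      grind
    · simp
    · intro i _ hi
      refine Finset.sum_eq_zero fun j _ => ?_
      grind
    · simp
  have h5 : (∑ i : Fin N, ∑ j : Fin N,
      if j < i then (qbar i * (qbar j)⁻¹) • (e i.rev j.rev ⊗ₖ e i j : Mat2 N K) else 0)
      (a, b) (c, d) = if a = b.rev ∧ c = d.rev ∧ d < b then qbar b * (qbar d)⁻¹ else 0 := by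
    simp only [e, Matrix.sum_apply, Matrix.ite_apply, Matrix.zero_apply, Matrix.smul_apply,
      Matrix.kroneckerMap_apply, Matrix.single_apply, mul_ite, mul_one, mul_zero, smul_eq_mul]
    rw [Finset.sum_eq_single b, Finset.sum_eq_single d]
    · grind
    · intro i _ hi
      grind
    · simp
    · intro i _ hi
      refine Finset.sum_eq_zero fun j _ => ?_
      grind
    · simp
  simp only [R0, Matrix.sub_apply, Matrix.add_apply, Matrix.smul_apply, h1, h2, h3, h4, h5,
    smul_eq_mul, Prod.mk.injEq, mul_ite, mul_one, mul_zero]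
  congr 1
  · congr 1
    · by_cases hab : a = b
      · subst hab
        by_cases hr : a = a.rev
        · simp only [← hr]
          grind
        · grind
      · grind
    · simp only [and_assoc]

end Entries

/-! ### The common polynomial R-matrix and its rows and columns of type A -/

section PolyR

open Polynomial in
/-- The polynomial `R`-matrix to which both `R(u)` and `R̄(u)` are proportional. -/
def RPoly (N : ℕ) : Mat2 N (Polynomial K) :=
  Matrix.of fun y z => C q⁻¹ * (X - 1) * (X - C (xi N)) * C (R0 N y z)
    - C (q⁻¹ ^ 2 - 1) * (X - C (xi N)) * C (P N y z)
    + C (q⁻¹ ^ 2 - 1) * (X - 1) * C (xi N) * C (Q N y z)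

theorem coe_RPoly (N : ℕ) (y z : Fin N × Fin N) : (RPoly N y z : K⟦X⟧) =
    PowerSeries.C q⁻¹ * (PowerSeries.X - 1) * (PowerSeries.X - PowerSeries.C (xi N))
        * PowerSeries.C (R0 N y z)
      - PowerSeries.C (q⁻¹ ^ 2 - 1) * (PowerSeries.X - PowerSeries.C (xi N))
        * PowerSeries.C (P N y z)
      + PowerSeries.C (q⁻¹ ^ 2 - 1) * (PowerSeries.X - 1) * PowerSeries.C (xi N)
        * PowerSeries.C (Q N y z) := by
  simp only [RPoly, Matrix.of_apply]
  push_cast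
  rfl

/-- The factor is q((uq - q^{-1})(u - ξ))^{-1} for the first matrix and f(u) for the second; both
have nonzero constant term. This allows U(R) and U(R̄) to be treated together. -/
theorem exists_isUnit_mul_RPoly {N : ℕ} {𝓡 : Mat2 N K⟦X⟧} (h : 𝓡 = RBar N ∨ 𝓡 = RMat N) :
    ∃ g : K⟦X⟧, IsUnit g ∧ ∀ y z, 𝓡 y z = g * (RPoly N y z : K⟦X⟧) := by
  have hq := q_ne_zero
  have hx := xi_ne_zero N
  rcases h with rfl | rfl
  · set a : K⟦X⟧ := PowerSeries.C q * PowerSeries.X - PowerSeries.C q⁻¹ with ha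
    set b : K⟦X⟧ := PowerSeries.X - PowerSeries.C (xi N) with hb
    have ha0 : PowerSeries.constantCoeff a ≠ 0 := by simp [ha, hq]
    have hb0 : PowerSeries.constantCoeff b ≠ 0 := by simp [hb, hx]
    have ha1 := PowerSeries.mul_inv_cancel a ha0
    have hb1 := PowerSeries.mul_inv_cancel b hb0
    have hab1 := PowerSeries.mul_inv_cancel (a * b) (by rw [map_mul]; exact mul_ne_zero ha0 hb0)
    have hinv : (a * b)⁻¹ = a⁻¹ * b⁻¹ := by
      rw [PowerSeries.mul_inv_rev, mul_comm]
    refine ⟨PowerSeries.C q * (a * b)⁻¹, ?_, fun y z => ?_⟩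
    · rw [PowerSeries.isUnit_iff_constantCoeff]
      apply Ne.isUnit
      simp [ha, hb, hq, hx]
    · have hqq : (PowerSeries.C q : K⟦X⟧) * PowerSeries.C q⁻¹ = 1 := by
        rw [← map_mul, mul_inv_cancel₀ hq, map_one]
      have hc : (PowerSeries.C q : K⟦X⟧) * PowerSeries.C (q⁻¹ ^ 2 - 1)
          = - PowerSeries.C (q - q⁻¹) := by
        rw [← map_mul, ← map_neg]
        congr 1
        field_simp
        ring
      simp only [RBar, Matrix.sub_apply, Matrix.add_apply, Matrix.smul_apply, Matrix.map_apply,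
        smul_eq_mul, coe_RPoly, ← ha, ← hb]
      rw [hinv]
      linear_combination (-(PowerSeries.X - 1) * PowerSeries.C (R0 N y z) * a⁻¹ * b * b⁻¹) * hqq
        + (a⁻¹ * b⁻¹ * b * PowerSeries.C (P N y z) - a⁻¹ * b⁻¹ * (PowerSeries.X - 1)
            * PowerSeries.C (xi N) * PowerSeries.C (Q N y z)) * hc
        - ((PowerSeries.X - 1) * PowerSeries.C (R0 N y z) * a⁻¹
          + PowerSeries.C (q - q⁻¹) * a⁻¹ * PowerSeries.C (P N y z)) * hb1
  · refine ⟨f N, ?_, fun y z => ?_⟩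
    · rw [PowerSeries.isUnit_iff_constantCoeff, f_zero]
      exact isUnit_one
    · simp only [RMat, Matrix.sub_apply, Matrix.add_apply, Matrix.smul_apply, Matrix.map_apply,
        smul_eq_mul, coe_RPoly]

/-- The diagonal coefficients of the `R`-matrix of type `A`. -/
def dco {N : ℕ} (i k : Fin N) (x : K) : K := if i = k then x * q - q⁻¹ else x - 1

/-- The off-diagonal coefficients of the `R`-matrix of type `A`. -/
def oco {N : ℕ} (i k : Fin N) (x : K) : K :=
  if i = k then 0 else if i < k then (q - q⁻¹) * x else q - q⁻¹

/-- The relations of type `A` satisfied by the entries of `L(u)` in the rows `i`, `k` and columns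
`j`, `l` such that `k ≠ i'` and `l ≠ j'`. -/
def TypeA {N : ℕ} {A : Type} [Ring A] [Algebra K A] (ε : Sgn)
    (L : Matrix (Fin N) (Fin N) A⟦X⟧) : Prop :=
  ∀ x : K, x ≠ 0 → ∀ i k j l : Fin N, k ≠ i.rev → l ≠ j.rev →
    dco i k x • (L i j * shift ε x⁻¹ (L k l)) + oco i k x • (L k j * shift ε x⁻¹ (L i l))
      = dco j l x • (shift ε x⁻¹ (L k l) * L i j) + oco l j x • (shift ε x⁻¹ (L k j) * L i l)

open Polynomial in
/-- `dco` as a polynomial. -/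
def dpoly {N : ℕ} (i k : Fin N) : Polynomial K := if i = k then X * C q - C q⁻¹ else X - 1

open Polynomial in
/-- `oco` as a polynomial. -/
def opoly {N : ℕ} (i k : Fin N) : Polynomial K :=
  if i = k then 0 else if i < k then C (q - q⁻¹) * X else C (q - q⁻¹)

theorem eval_dpoly {N : ℕ} (i k : Fin N) (x : K) : (dpoly i k).eval x = dco i k x := by
  unfold dpoly dco; split_ifs <;> simp; ring

theorem eval_opoly {N : ℕ} (i k : Fin N) (x : K) : (opoly i k).eval x = oco i k x := by
  unfold opoly oco; split_ifs <;> simp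

-- Q and the last sum in R are supported on index pairs of the form (i', i). Every other row
-- contains only the R-matrix of type A, with the factor q^{-1}(u - ξ) split off.
open Polynomial in
theorem RPoly_row {N : ℕ} (y z : Fin N × Fin N) (h : y.1 ≠ y.2.rev) :
    RPoly N y z = C q⁻¹ * (X - C (xi N)) *
      ((if z = y then dpoly y.1 y.2 else 0) + (if z = (y.2, y.1) then opoly y.1 y.2 else 0)) := by
  obtain ⟨a, b⟩ := y
  have hq := q_ne_zero
  have hqq : (C q : Polynomial K) * C q⁻¹ = 1 := by
    rw [← map_mul, mul_inv_cancel₀ hq, map_one]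
  simp only at h
  simp only [RPoly, Matrix.of_apply, R0_apply, P_apply, Q_apply, h, false_and, if_false, sub_zero,
    map_zero, mul_zero, add_zero, dpoly, opoly, map_sub, map_pow, map_one]
  by_cases hab : a = b
  · subst hab
    by_cases hz : z = (a, a)
    · subst hz
      simp [h]
      linear_combination (X - C (xi N)) * (X - 1 - X)* hqq
    · simp [hz]
  · by_cases hz : z = (a, b)
    · subst hz
      have : (a, b) ≠ (b, a) := fun h' => hab (congrArg Prod.fst h')
      simp [hab, this]
      ring
    · by_cases hz' : z = (b, a)
      · subst hz'
        simp only [hz, hab, if_false, zero_add, true_and, if_true]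
        split_ifs with hlt
        · simp
          linear_combination (X - C (xi N)) * (- 1 )* hqq
        · simp
          linear_combination (X - C (xi N)) * (- 1 )* hqq
      · simp [hz, hz']

open Polynomial in
theorem RPoly_col {N : ℕ} (y z : Fin N × Fin N) (h : z.1 ≠ z.2.rev) :
    RPoly N y z = C q⁻¹ * (X - C (xi N)) *
      ((if y = z then dpoly z.1 z.2 else 0) + (if y = (z.2, z.1) then opoly z.2 z.1 else 0)) := by
  by_cases hy : y.1 = y.2.rev
  · have h1 : y ≠ z := fun h' => h (h' ▸ hy)
    have h2 : y ≠ (z.2, z.1) := by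
      intro h'
      rw [h'] at hy
      exact h (by simp only at hy; rw [hy, Fin.rev_rev])
    have h3 : z ≠ (y.2, y.1) := fun h' => h2 (by rw [h'])
    simp [RPoly, R0_apply, P_apply, Q_apply, h, h1, h2, h3, Ne.symm h1]
  · rw [RPoly_row y z hy]
    congr 2
    · by_cases h1 : y = z
      · simp [h1]
      · simp [h1, Ne.symm h1]
    · by_cases h1 : y = (z.2, z.1)
      · simp [h1]
      · have h3 : z ≠ (y.2, y.1) := fun h' => h1 (by rw [h'])
        simp [h1, h3]

variable {N : ℕ} {𝓡 : Mat2 N K⟦X⟧} {c : ZeroModes}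

/-- The factor q^{-1}(u - ξ) from the rows and columns of type A is itself a unit as a power series,
because ξ ≠ 0; it is absorbed into the common factor before evaluation, so x = ξ needs no exception.
-/
theorem typeA_LMat (h : 𝓡 = RBar N ∨ 𝓡 = RMat N) (ε : Sgn) : TypeA ε (LMat 𝓡 c ε) := by
  intro x hx i k j l hik hjl
  obtain ⟨g, hg, hR⟩ := exists_isUnit_mul_RPoly h
  have hu : IsUnit (PowerSeries.C q⁻¹ * (PowerSeries.X - PowerSeries.C (xi N)) : K⟦X⟧) := by
    rw [PowerSeries.isUnit_iff_constantCoeff]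
    apply Ne.isUnit
    simp [q_ne_zero, xi_ne_zero]
  have hik' : i ≠ k.rev := fun h' => hik (by rw [h', Fin.rev_rev])
  have hjl' : j ≠ l.rev := fun h' => hjl (by rw [h', Fin.rev_rev])
  have := rll_eval (𝓡 := 𝓡) (c := c) ε (hg.mul hu) i k j l
    (fun z => (if z = (i, k) then dpoly i k else 0) + (if z = (k, i) then opoly i k else 0))
    (fun y => (if y = (j, l) then dpoly j l else 0) + (if y = (l, j) then opoly l j else 0))
    (fun z => by
      rw [hR, RPoly_row _ _ hik', mul_assoc g]
      simp only [Polynomial.coe_mul, Polynomial.coe_sub, Polynomial.coe_C, Polynomial.coe_X])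
    (fun z => by
      rw [hR, RPoly_col _ _ hjl', mul_assoc g]
      simp only [Polynomial.coe_mul, Polynomial.coe_sub, Polynomial.coe_C, Polynomial.coe_X]) x hx
  simp only [Polynomial.eval_add, apply_ite (Polynomial.eval x), Polynomial.eval_zero, eval_dpoly,
    eval_opoly, add_smul, Finset.sum_add_distrib, ite_smul, zero_smul, Finset.sum_ite_eq',
    Finset.mem_univ, if_true] at this
  exact this

end PolyR

/-! ### The existence of the series `z(u)` -/

section ExistsZ

theorem C_algebraMap_mul {A : Type} [Ring A] [Algebra K A] (r : K) (g : A⟦X⟧) :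
    PowerSeries.C (algebraMap K A r) * g = r • g := by
  ext m
  rw [PowerSeries.coeff_C_mul, coeff_K_smul, Algebra.smul_def]

theorem mul_C_algebraMap {A : Type} [Ring A] [Algebra K A] (r : K) (g : A⟦X⟧) :
    g * PowerSeries.C (algebraMap K A r) = r • g := by
  ext m
  rw [PowerSeries.coeff_mul_C, coeff_K_smul, Algebra.smul_def, Algebra.commutes]

theorem D_mul_mul_DInv_apply {N : ℕ} {A : Type} [Ring A] [Algebra K A] (ε : Sgn)
    (L : Matrix (Fin N) (Fin N) A⟦X⟧) (a b : Fin N) :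
    (DMat N A * tr (L.map (shift ε (xi N))) * DInv N A) a b
      = (qbar a * (qbar b)⁻¹) • shift ε (xi N) (L b.rev a.rev) := by
  rw [DMat, DInv, Matrix.mul_diagonal, Matrix.diagonal_mul, C_algebraMap_mul, mul_C_algebraMap,
    smul_smul, mul_comm]
  rfl

variable {N : ℕ} {𝓡 : Mat2 N K⟦X⟧} {c : ZeroModes}

theorem eval_RPoly_xi (y z : Fin N × Fin N) : (RPoly N y z).eval (xi N)
    = (q⁻¹ ^ 2 - 1) * (xi N - 1) * xi N * Q N y z := by
  simp [RPoly]

theorem sum_Q_row {V : Type*} [AddCommGroup V] [Module K V] (i k : Fin N)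
    (T : Fin N × Fin N → V) : ∑ y, Q N (i, k) y • T y
      = if i = k.rev then ∑ b, (qbar k * (qbar b)⁻¹) • T (b.rev, b) else 0 := by
  rw [Fintype.sum_prod_type, Finset.sum_comm]
  simp only [Q_apply]
  split_ifs with h
  · refine Finset.sum_congr rfl fun b _ => ?_
    simp [h, ite_smul]
  · simp [h]

theorem sum_Q_col {V : Type*} [AddCommGroup V] [Module K V] (j l : Fin N)
    (T : Fin N × Fin N → V) : ∑ y, Q N y (j, l) • T y
      = if j = l.rev then ∑ b, (qbar b * (qbar l)⁻¹) • T (b.rev, b) else 0 := by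
  rw [Fintype.sum_prod_type, Finset.sum_comm]
  simp only [Q_apply]
  split_ifs with h
  · refine Finset.sum_congr rfl fun b _ => ?_
    simp [h, ite_smul]
  · simp [h]

theorem inv_q_sq_ne_one : q⁻¹ ^ 2 - 1 ≠ 0 := by
  rw [sub_ne_zero, ← zpow_natCast, inv_zpow']
  exact q_zpow_ne_one (by norm_num)

/-- This is the relation at u/v = ξ, where `RPoly` is Q times (q^{-2} - 1)(ξ - 1)ξ. The scalar is
nonzero because ξ = q^{2-N} differs from 1 when N ≥ 3. -/
theorem Q_relation (hN : 3 ≤ N) (h : 𝓡 = RBar N ∨ 𝓡 = RMat N) (ε : Sgn) (i k j l : Fin N) :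
    (if i = k.rev then ∑ b : Fin N, (qbar k * (qbar b)⁻¹) •
        (shift ε (xi N) (LMat 𝓡 c ε b.rev j) * LMat 𝓡 c ε b l) else 0)
      = if j = l.rev then ∑ b : Fin N, (qbar b * (qbar l)⁻¹) •
        (LMat 𝓡 c ε k b * shift ε (xi N) (LMat 𝓡 c ε i b.rev)) else 0 := by
  obtain ⟨g, hg, hR⟩ := exists_isUnit_mul_RPoly h
  have hx := xi_ne_zero N
  have hx1 : xi N - 1 ≠ 0 := sub_ne_zero.2 (q_zpow_ne_one (by omega))
  have := rll_eval (𝓡 := 𝓡) (c := c) ε hg i k j l (fun z => RPoly N (i, k) z)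
    (fun y => RPoly N y (j, l)) (fun z => hR _ _) (fun z => hR _ _) (xi N) hx
  simp only [eval_RPoly_xi, ← smul_smul, ← Finset.smul_sum] at this
  have h2 := smul_right_injective _ hx <| smul_right_injective _ hx1 <|
    smul_right_injective _ inv_q_sq_ne_one this
  -- The arguments are u and uξ^{-1}; the substitution u ↦ uξ turns them into uξ and u.
  have h3 := congrArg (shiftHom ε (xi N) hx) h2
  simp only [map_sum, map_smul, map_mul] at h3
  simp only [shiftHom_apply, shift_shift, mul_inv_cancel₀ hx, shift_one] at h3
  rw [sum_Q_row, sum_Q_col] at h3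
  exact h3

/-- Since Q has rank one, `Q_relation` compares single entries of ML and LM. With both conditions
true it equates every diagonal entry of ML with every diagonal entry of LM; with only one true it
kills an off-diagonal entry. -/
theorem exists_isZ_of_three_le (hN : 3 ≤ N) (h : 𝓡 = RBar N ∨ 𝓡 = RMat N) (ε : Sgn) :
    ∃ z, IsZ ε (LMat 𝓡 c ε) z := by
  set L := LMat 𝓡 c ε with hL
  set M := DMat N (U 𝓡 c) * tr (L.map (shift ε (xi N))) * DInv N (U 𝓡 c) with hM
  have hQ := Q_relation (c := c) hN h ε
  have hLM : ∀ a b, (L * M) a b = ∑ j, (qbar j * (qbar b)⁻¹) •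
      (L a j * shift ε (xi N) (L b.rev j.rev)) := by
    intro a b
    rw [Matrix.mul_apply]
    refine Finset.sum_congr rfl fun j _ => ?_
    rw [hM, D_mul_mul_DInv_apply, mul_smul_comm]
  have hML : ∀ a b, (M * L) a b = ∑ j, (qbar a * (qbar j)⁻¹) •
      (shift ε (xi N) (L j.rev a.rev) * L j b) := by
    intro a b
    rw [Matrix.mul_apply]
    refine Finset.sum_congr rfl fun j _ => ?_
    rw [hM, D_mul_mul_DInv_apply, smul_mul_assoc]
  have hdiag : ∀ k l, (M * L) l l = (L * M) k k := by
    intro k l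
    have h1 := hQ k.rev k l.rev l
    rw [if_pos rfl, if_pos rfl] at h1
    have h2 : (qbar k * (qbar l)⁻¹) • (M * L) l l = (qbar k * (qbar l)⁻¹) • (L * M) k k := by
      rw [hML, hLM, Finset.smul_sum, Finset.smul_sum]
      have hk := qbar_ne_zero k
      have hl := qbar_ne_zero l
      convert h1 using 1
      · refine Finset.sum_congr rfl fun b _ => ?_
        rw [smul_smul]
        congr 1
        field_simp
      · refine Finset.sum_congr rfl fun b _ => ?_
        rw [smul_smul]
        congr 1
        field_simp
    exact smul_right_injective _ (mul_ne_zero (qbar_ne_zero k) (inv_ne_zero (qbar_ne_zero l))) h2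
  refine ⟨(L * M) ⟨0, by omega⟩ ⟨0, by omega⟩, ?_, ?_⟩
  · ext1 a b
    rw [← hM, Matrix.diagonal_apply]
    split_ifs with hab
    · subst hab
      rw [← hdiag a a, ← hdiag ⟨0, by omega⟩ a]
    · have h1 := hQ b.rev a b.rev b
      rw [if_neg (fun h' => hab (Fin.rev_injective h').symm), if_pos rfl] at h1
      rw [hLM, ← h1]
  · ext1 a b
    rw [← hM, Matrix.diagonal_apply]
    split_ifs with hab
    · subst hab
      rw [hdiag]
    · have h1 := hQ a.rev a a.rev b
      rw [if_neg (fun h' => hab (Fin.rev_injective h')), if_pos rfl] at h1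
      rw [hML, h1]

/-! ### The degenerate case N = 2, where ξ = 1 -/

theorem xi_two : xi 2 = 1 := by simp [xi]

-- For N = 2 everything is divisible by X - 1, and the quotient is diagonal. At x = 1 its entries
-- are 1 - q^{-2} and its negative, so any two entries of L(u) commute or anticommute, as recorded
-- in `diag_relation_two`.
open Polynomial in
theorem RPoly_two (y z : Fin 2 × Fin 2) : RPoly 2 y z = (X - 1) *
    (if z = y then (if y.1 = y.2 then X - C (q⁻¹ ^ 2) else C (q⁻¹ ^ 2) * X - 1) else 0) := by
  have hqq : (C q : Polynomial K) * C q⁻¹ = 1 := by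
    rw [← map_mul, mul_inv_cancel₀ q_ne_zero, map_one]
  have hb : ∀ i : Fin 2, qbar i = 1 := by
    intro i
    fin_cases i <;> simp [qbar, bar2, Fin.rev]
  obtain ⟨a, b⟩ := y
  obtain ⟨c, d⟩ := z
  simp only [RPoly, R0_apply, P_apply, Q_apply, Matrix.of_apply, hb, xi_two, map_pow, map_sub,
    map_one]
  fin_cases a <;> fin_cases b <;> fin_cases c <;> fin_cases d <;> simp [Fin.rev] <;>
    first | ring1 | linear_combination (X - 1) ^ 2 * hqq

theorem diag_relation_two {𝓡 : Mat2 2 K⟦X⟧} (h : 𝓡 = RBar 2 ∨ 𝓡 = RMat 2) (ε : Sgn)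
    (i k j l : Fin 2) :
    (if i = k then (1 : K) else -1) • (LMat 𝓡 c ε i j * LMat 𝓡 c ε k l)
      = (if j = l then (1 : K) else -1) • (LMat 𝓡 c ε k l * LMat 𝓡 c ε i j) := by
  obtain ⟨g, hg, hR⟩ := exists_isUnit_mul_RPoly h
  have hu : IsUnit (PowerSeries.X - 1 : K⟦X⟧) := by
    rw [PowerSeries.isUnit_iff_constantCoeff]
    simp
  have := rll_eval (𝓡 := 𝓡) (c := c) ε (hg.mul hu) i k j l
    (fun z => if z = (i, k) then
      (if i = k then .X - .C (q⁻¹ ^ 2) else .C (q⁻¹ ^ 2) * .X - 1) else 0)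
    (fun y => if y = (j, l) then
      (if j = l then .X - .C (q⁻¹ ^ 2) else .C (q⁻¹ ^ 2) * .X - 1) else 0)
    (fun z => by
      rw [hR, RPoly_two, mul_assoc g]
      simp only [Polynomial.coe_mul, Polynomial.coe_sub, Polynomial.coe_one, Polynomial.coe_X])
    (fun z => by
      rw [hR, RPoly_two, mul_assoc g]
      simp only [Polynomial.coe_mul, Polynomial.coe_sub, Polynomial.coe_one, Polynomial.coe_X]
      by_cases hz : z = (j, l)
      · simp [hz]
      · simp [hz, Ne.symm hz]) 1 one_ne_zero
  simp only [apply_ite (Polynomial.eval (1 : K)), Polynomial.eval_zero, Polynomial.eval_sub,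
    Polynomial.eval_X, Polynomial.eval_C, Polynomial.eval_mul, Polynomial.eval_one, mul_one,
    ite_smul, zero_smul, Finset.sum_ite_eq', Finset.mem_univ, if_true, inv_one,
    shift_one] at this
  have hs : ∀ p : Prop, [Decidable p] → (if p then 1 - q⁻¹ ^ 2 else q⁻¹ ^ 2 - 1 : K)
      = (q⁻¹ ^ 2 - 1) * (- if p then 1 else -1) := by
    intro p _
    split_ifs <;> ring
  rw [← ite_smul, ← ite_smul, hs, hs, mul_smul, mul_smul] at this
  have h2 := smul_right_injective _ inv_q_sq_ne_one this
  rw [neg_smul, neg_smul, neg_inj] at h2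
  exact h2

theorem exists_isZ_two {𝓡 : Mat2 2 K⟦X⟧} (h : 𝓡 = RBar 2 ∨ 𝓡 = RMat 2) (ε : Sgn) :
    ∃ z, IsZ ε (LMat 𝓡 c ε) z := by
  have hb : ∀ i : Fin 2, qbar i = 1 := by
    intro i
    fin_cases i <;> simp [qbar, bar2, Fin.rev]
  have hr := diag_relation_two (c := c) h ε
  set L := LMat 𝓡 c ε with hL
  have hM : ∀ a b, (DMat 2 (U 𝓡 c) * tr (L.map (shift ε (xi 2))) * DInv 2 (U 𝓡 c)) a b
      = L b.rev a.rev := by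
    intro a b
    rw [D_mul_mul_DInv_apply, hb, hb, xi_two, shift_one, inv_one, mul_one, one_smul]
  have r1 : L 0 0 * L 0 1 = -(L 0 1 * L 0 0) := by simpa using hr 0 0 0 1
  have r2 : L 1 0 * L 1 1 = -(L 1 1 * L 1 0) := by simpa using hr 1 1 0 1
  have r3 : L 0 0 * L 1 0 = -(L 1 0 * L 0 0) := by simpa [neg_eq_iff_eq_neg] using hr 0 1 0 0
  have r4 : L 0 1 * L 1 1 = -(L 1 1 * L 0 1) := by simpa [neg_eq_iff_eq_neg] using hr 0 1 1 1
  have r5 : L 0 0 * L 1 1 = L 1 1 * L 0 0 := by simpa using hr 0 1 0 1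
  have r6 : L 0 1 * L 1 0 = L 1 0 * L 0 1 := by simpa using hr 0 1 1 0
  have e0 : (0 : Fin 2).rev = 1 := rfl
  have e1 : (1 : Fin 2).rev = 0 := rfl
  refine ⟨L 0 0 * L 1 1 + L 0 1 * L 1 0, ?_, ?_⟩
  · ext1 a b
    rw [Matrix.mul_apply, Fin.sum_univ_two, hM, hM, Matrix.diagonal_apply]
    fin_cases a <;> fin_cases b <;> simp [e0, e1, r1, r2, r5, r6, add_comm]
  · ext1 a b
    rw [Matrix.mul_apply, Fin.sum_univ_two, hM, hM, Matrix.diagonal_apply]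
    fin_cases a <;> fin_cases b <;> simp [e0, e1, r3, r4, r5, r6, add_comm]

theorem exists_isZ (hN : 2 ≤ N) (h : 𝓡 = RBar N ∨ 𝓡 = RMat N) (ε : Sgn) :
    ∃ z, IsZ ε (LMat 𝓡 c ε) z := by
  rcases Nat.lt_or_ge 2 N with h3 | h3
  · exact exists_isZ_of_three_le h3 h ε
  · obtain rfl : N = 2 := le_antisymm h3 hN
    exact exists_isZ_two h ε

end ExistsZ

/-! ### Twisted `q`-Manin matrices and their Schur complements -/

section Manin

variable {N : ℕ} {𝕜 : Type*} [Field 𝕜] {B : Type} [Ring B] [Algebra 𝕜 B] {t : 𝕜}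

/-- The `q`-minors of size two, twisted by `σ`. -/
def minor (t : 𝕜) (σ : B →ₐ[𝕜] B) (Y : Matrix (Fin N) (Fin N) B) (i k j l : Fin N) : B :=
  Y i j * σ (Y k l) - t⁻¹ • (Y k j * σ (Y i l))

/-- The relations of a `q`-Manin matrix twisted by `σ`, in the rows and columns that remain after
removal of the first `m` and the last `m` ones, with the exception of the pairs `(i, i')`. -/
structure Manin (t : 𝕜) (σ : B →ₐ[𝕜] B) (Y : Matrix (Fin N) (Fin N) B) (m : ℕ) : Prop where
  same : ∀ i k j : Fin N, m ≤ (i : ℕ) → i < k → (k : ℕ) + m < N → k ≠ i.rev →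
    m ≤ (j : ℕ) → (j : ℕ) + m < N → j ≠ j.rev → minor t σ Y i k j j = 0
  swap : ∀ i k j l : Fin N, m ≤ (i : ℕ) → i < k → (k : ℕ) + m < N → k ≠ i.rev →
    m ≤ (j : ℕ) → j < l → (l : ℕ) + m < N → l ≠ j.rev →
    minor t σ Y i k j l = -(t • minor t σ Y i k l j)

/-- These are the expansions of the twisted 3 × 3 q-minor with rows p, i, k and columns j, l, m
along its first and along its last column; written out, both are the same signed sum over
permutations of the rows, so no relation on Y is needed. -/
theorem minor_expansion (σ : B →ₐ[𝕜] B) (Y : Matrix (Fin N) (Fin N) B) (p i k j l m : Fin N) :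
    Y p j * σ (minor t σ Y i k l m) - t⁻¹ • (Y i j * σ (minor t σ Y p k l m))
        + (t⁻¹ * t⁻¹) • (Y k j * σ (minor t σ Y p i l m))
      = minor t σ Y p i j l * σ (σ (Y k m)) - t⁻¹ • (minor t σ Y p k j l * σ (σ (Y i m)))
        + (t⁻¹ * t⁻¹) • (minor t σ Y i k j l * σ (σ (Y p m))) := by
  simp only [minor, map_sub, map_smul, map_mul, mul_sub, sub_mul, smul_sub, smul_mul_assoc,
    mul_smul_comm, smul_smul, mul_assoc]
  module

variable {σ : B →ₐ[𝕜] B} {Y : Matrix (Fin N) (Fin N) B} {p : Fin N}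

/-- The vanishing minor allows Y_{pp} to move past σ(Y_{ip}) as σ(Y_{pp}), which then cancels the
inverse inside the Schur complement. -/
theorem mul_map_schur_eq_minor (ha : IsUnit (Y p p)) (i j : Fin N) (h : minor t σ Y p i p p = 0) :
    Y p p * σ (Y i j - Y i p * Ring.inverse (Y p p) * Y p j) = minor t σ Y p i p j := by
  have h1 : Y p p * σ (Y i p) = t⁻¹ • (Y i p * σ (Y p p)) := by
    rwa [minor, sub_eq_zero] at h
  have h2 : σ (Y p p) * σ (Ring.inverse (Y p p)) = 1 := by
    rw [← map_mul, Ring.mul_inverse_cancel _ ha, map_one]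
  rw [map_sub, map_mul, map_mul, mul_sub, mul_assoc (σ (Y i p)), ← mul_assoc (Y p p) (σ (Y i p)),
    h1, smul_mul_assoc, mul_assoc, ← mul_assoc (σ (Y p p)), h2, one_mul, minor]

/-- Both sides are the same 2 × 2 minor, computed with its columns in the two orders. The difference
on the left has its factors in the order that occurs in the Schur complement of a transposed matrix.
-/
theorem flip_schur_mul (ht : t ≠ 0) (ha : IsUnit (Y p p)) (i j : Fin N) (h : minor t σ Y p j p p = 0)
    (h' : minor t σ Y p j p i = -(t • minor t σ Y p j i p)) :
    (Y j i - Y p i * Ring.inverse (Y p p) * Y j p) * σ (Y p p)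
      = Y p p * σ (Y j i - Y j p * Ring.inverse (Y p p) * Y p i) := by
  rw [mul_map_schur_eq_minor ha _ _ h, h']
  have h1 : Y j p * σ (Y p p) = t • (Y p p * σ (Y j p)) := by
    rw [minor, sub_eq_zero] at h
    rw [h, smul_smul, mul_inv_cancel₀ ht, one_smul]
  rw [sub_mul, mul_assoc, h1, mul_smul_comm, mul_assoc, ← mul_assoc (Ring.inverse (Y p p)),
    Ring.inverse_mul_cancel _ ha, one_mul, minor, smul_sub, smul_smul, mul_inv_cancel₀ ht,
    one_smul, neg_sub]

/-- A Sylvester identity: the right side is the 3 × 3 minor with rows p, i, k and columns p, j, l,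
expanded along column p. -/
theorem mul_map_minor_schur (ht : t ≠ 0) (ha : IsUnit (Y p p)) {S : Matrix (Fin N) (Fin N) B}
    (hS : ∀ i j, S i j = Y i j - Y i p * Ring.inverse (Y p p) * Y p j) (i k j l : Fin N)
    (h1 : minor t σ Y p i p p = 0) (h2 : minor t σ Y p k p p = 0) (h3 : minor t σ Y i k p p = 0)
    (h1' : minor t σ Y p i p j = -(t • minor t σ Y p i j p))
    (h2' : minor t σ Y p k p j = -(t • minor t σ Y p k j p))
    (h3' : minor t σ Y i k p j = -(t • minor t σ Y i k j p)) :
    Y p p * σ (minor t σ S i k j l) = Y p p * σ (minor t σ Y i k j l)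
      - t⁻¹ • (Y i p * σ (minor t σ Y p k j l)) + (t⁻¹ * t⁻¹) • (Y k p * σ (minor t σ Y p i j l)) := by
  have hinv : σ (σ (Y p p)) * σ (σ (Ring.inverse (Y p p))) = 1 := by
    rw [← map_mul, ← map_mul, Ring.mul_inverse_cancel _ ha, map_one, map_one]
  -- This is the vanishing of the 3 × 3 minor with columns p, j, p. With columns p, p, j it vanishes
  -- by expansion along the last column, and the swap relations exchange the last two columns in the
  -- expansion along the first.
  have hT : minor t σ Y p i p j * σ (σ (Y k p)) - t⁻¹ • (minor t σ Y p k p j * σ (σ (Y i p)))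
      = -((t⁻¹ * t⁻¹) • (minor t σ Y i k p j * σ (σ (Y p p)))) := by
    rw [← add_eq_zero_iff_eq_neg, ← minor_expansion]
    have := minor_expansion (t := t) σ Y p i k p p j
    rw [h1, h2, h3, h1', h2', h3'] at this
    simp only [map_neg, map_smul, zero_mul, smul_zero, sub_zero, add_zero] at this
    have e : ∀ a b c : B, a * -(t • b) = -(t • (a * b)) := fun a b _ => by
      rw [mul_neg, mul_smul_comm]
    rw [e _ _ 0, e _ _ 0, e _ _ 0] at this
    have h4 : -(t • (Y p p * σ (minor t σ Y i k j p) - t⁻¹ • (Y i p * σ (minor t σ Y p k j p))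
        + (t⁻¹ * t⁻¹) • (Y k p * σ (minor t σ Y p i j p)))) = 0 := by
      rw [← this]; module
    rw [neg_eq_zero] at h4
    exact (smul_eq_zero.1 h4).resolve_left ht
  rw [minor_expansion, minor, map_sub, map_smul, map_mul, map_mul, mul_sub, mul_smul_comm,
    ← mul_assoc, ← mul_assoc, hS i j, hS k j, mul_map_schur_eq_minor ha _ _ h1,
    mul_map_schur_eq_minor ha _ _ h2, hS, hS]
  simp only [map_sub, map_mul, mul_sub]
  have h5 : ∀ a b c d : B, a * (b * c * d) = a * b * (c * d) := by intros; noncomm_ring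
  rw [h5, h5, smul_sub, ← smul_mul_assoc t⁻¹ (minor t σ Y p k p j * σ (σ (Y i p)))]
  have h6 : ∀ a b c d : B, a - b - (c - d) = a - c - (b - d) := by intros; abel
  rw [h6, ← sub_mul, hT, neg_mul, smul_mul_assoc, mul_assoc, ← mul_assoc (σ (σ (Y p p))), hinv,
    one_mul, sub_neg_eq_add]

/-- After multiplication by the pivot, minors of the new Schur complement are combinations of minors
of the old one with the same columns, so both kinds of relations are inherited. The ranges of the
indices exclude p', hence every auxiliary pair of indices involving p is admissible. -/
theorem Manin.schur_succ (ht : t ≠ 0) {L : Matrix (Fin N) (Fin N) B}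
    (hσ : Function.Injective σ)
    (hp : 2 * (p : ℕ) + 1 < N) (ha : IsUnit (piv L p)) (h : Manin t σ (schur L p) p) :
    Manin t σ (schur L (p + 1)) (p + 1) := by
  have key : ∀ i k j l : Fin N, (p : ℕ) + 1 ≤ i → i < k → (k : ℕ) + (p + 1) < N → k ≠ i.rev →
      (p : ℕ) + 1 ≤ j → (j : ℕ) + (p + 1) < N →
      schur L p p p * σ (minor t σ (schur L (p + 1)) i k j l)
      = schur L p p p * σ (minor t σ (schur L p) i k j l)
        - t⁻¹ • (schur L p i p * σ (minor t σ (schur L p) p k j l))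
        + (t⁻¹ * t⁻¹) • (schur L p k p * σ (minor t σ (schur L p) p i j l)) := by
    intro i k j l hi hik hk hne hj hj'
    simp only [Fin.lt_def, ne_eq, Fin.ext_iff, Fin.val_rev] at *
    refine mul_map_minor_schur ht ha (fun i j => QAffine.schur_succ L p i j) i k j l ?_ ?_ ?_ ?_ ?_ ?_
    all_goals first
      | (apply h.same <;> (try simp only [Fin.lt_def, ne_eq, Fin.ext_iff, Fin.val_rev]) <;> omega)
      | (apply h.swap <;> (try simp only [Fin.lt_def, ne_eq, Fin.ext_iff, Fin.val_rev]) <;> omega)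
  constructor
  · intro i k j hi hik hk hne hj hj' hjj
    have := key i k j j hi hik hk hne hj hj'
    rw [h.same i k j (by omega) hik (by omega) hne (by omega) (by omega) hjj,
      h.same p k j le_rfl ?_ (by omega) ?_ (by omega) (by omega) hjj,
      h.same p i j le_rfl ?_ ?_ ?_ (by omega) (by omega) hjj] at this
    · apply hσ
      rw [map_zero]
      apply ha.mul_left_cancel
      rw [piv, this]
      simp
    all_goals
      simp only [Fin.lt_def, ne_eq, Fin.ext_iff, Fin.val_rev] at *
      omega
  · intro i k j l hi hik hk hne hj hjl hl hjl'
    have h1 := key i k j l hi hik hk hne hj (by simp only [Fin.lt_def] at *; omega)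
    have h2 := key i k l j hi hik hk hne (by simp only [Fin.lt_def] at *; omega) hl
    rw [h.swap i k j l (by omega) hik (by omega) hne (by omega) hjl (by omega) hjl',
      h.swap p k j l le_rfl ?_ (by omega) ?_ (by omega) hjl (by omega) hjl',
      h.swap p i j l le_rfl ?_ ?_ ?_ (by omega) hjl (by omega) hjl'] at h1
    · apply hσ
      apply ha.mul_left_cancel
      simp only [map_neg, map_smul, mul_neg, mul_smul_comm] at h1 ⊢
      rw [piv, h1, h2]
      module
    all_goals
      simp only [Fin.lt_def, ne_eq, Fin.ext_iff, Fin.val_rev] at *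
      omega

theorem swap_of_relations {V : Type*} [AddCommGroup V] [Module 𝕜 V] (ht : t ≠ 0) (c : 𝕜)
    {x₁ x₂ y₁ y₂ z₁ z₂ : V} (h1 : -c • x₁ + (c * t⁻¹) • x₂ = -c • z₁ + (c * t) • z₂)
    (h2 : -c • y₁ + (c * t⁻¹) • y₂ = -c • z₂ + (c * t⁻¹) • z₁) :
    c • (x₁ - t⁻¹ • x₂) = c • -(t • (y₁ - t⁻¹ • y₂)) := by
  have e1 : c • (x₁ - t⁻¹ • x₂) = -(-c • x₁ + (c * t⁻¹) • x₂) := by module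
  have e2 : c • -(t • (y₁ - t⁻¹ • y₂)) = t • (-c • y₁ + (c * t⁻¹) • y₂) := by module
  have : t * (c * t⁻¹) = c := by field_simp
  rw [e1, e2, h1, h2, smul_add, smul_smul t (c * t⁻¹), this]
  module

/-- At x = q^{-2} the coefficient xq - q^{-1} vanishes. The right side of the relation is therefore
zero for equal columns, while exchanging two distinct columns multiplies it by a power of q up to
sign. -/
theorem TypeA.manin {A : Type} [Ring A] [Algebra K A] {ε : Sgn} {L : Matrix (Fin N) (Fin N) A⟦X⟧}
    (h : TypeA ε L) : Manin q (shiftHom ε (q ^ 2) (pow_ne_zero 2 q_ne_zero)) L 0 := by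
  have hq := q_ne_zero
  have hc : q⁻¹ * (q - q⁻¹) ≠ 0 := mul_ne_zero (inv_ne_zero hq) q_sub_inv_ne_zero
  have hx0 : (q ^ 2)⁻¹ ≠ 0 := inv_ne_zero (pow_ne_zero 2 hq)
  have e1 : (q ^ 2)⁻¹ - 1 = -(q⁻¹ * (q - q⁻¹)) := by field_simp; ring
  have e2 : (q - q⁻¹) * (q ^ 2)⁻¹ = q⁻¹ * (q - q⁻¹) * q⁻¹ := by field_simp
  have e3 : (q ^ 2)⁻¹ * q - q⁻¹ = 0 := by field_simp; ring
  have e4 : q - q⁻¹ = q⁻¹ * (q - q⁻¹) * q := by field_simp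
  constructor
  · intro i k j _ hik _ hne _ _ hj
    have := h _ hx0 i k j j hne hj
    simp only [dco, oco, hik.ne, hik, if_true, if_false, inv_inv, e3, e1, e2, zero_smul,
      add_zero] at this
    apply smul_right_injective _ (neg_ne_zero.2 hc)
    simp only [minor, shiftHom_apply, smul_zero]
    rw [← this, smul_sub, smul_smul, neg_mul, neg_smul (q⁻¹ * (q - q⁻¹) * q⁻¹), sub_neg_eq_add]
  · intro i k j l _ hik _ hne _ hjl _ hne'
    have h1 := h _ hx0 i k j l hne hne'
    have h2 := h _ hx0 i k l j hne (fun h' => hne' (by rw [h', Fin.rev_rev]))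
    simp only [dco, oco, hik.ne, hik, hjl.ne, hjl, hjl.ne', hjl.asymm, if_true, if_false, inv_inv,
      e1, e2] at h1 h2
    nth_rw 4 [e4] at h1
    apply smul_right_injective _ hc
    exact swap_of_relations hq _ h1 h2

end Manin

/-! ### Elimination in the product `L(u) ⋅ D L(uξ)ᵗ D⁻¹` -/

section Chain

variable {N : ℕ} {A : Type} [Ring A] [Algebra K A]

/-- The product of `h_i(uξq^{2i})` over `i < m`, in increasing order. -/
def prodA (ε : Sgn) (L : Matrix (Fin N) (Fin N) A⟦X⟧) : ℕ → A⟦X⟧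
  | 0 => 1
  | m + 1 => if h : m < N then
      prodA ε L m * shift ε (xi N * q ^ (2 * m)) (piv L ⟨m, h⟩) else prodA ε L m

/-- The product of `h_i(uξq^{2i+2})⁻¹` over `i < m`, in decreasing order. -/
def prodB (ε : Sgn) (L : Matrix (Fin N) (Fin N) A⟦X⟧) : ℕ → A⟦X⟧
  | 0 => 1
  | m + 1 => if h : m < N then
      Ring.inverse (shift ε (xi N * q ^ (2 * (m + 1))) (piv L ⟨m, h⟩)) * prodB ε L m
      else prodB ε L m

theorem xi_mul_q_pow_ne_zero (N m : ℕ) : xi N * q ^ m ≠ 0 :=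
  mul_ne_zero (xi_ne_zero N) (pow_ne_zero _ q_ne_zero)

variable {ε : Sgn} {L : Matrix (Fin N) (Fin N) A⟦X⟧}

theorem prodA_succ (p : Fin N) : prodA ε L (p + 1)
    = prodA ε L p * shift ε (xi N * q ^ (2 * (p : ℕ))) (piv L p) := by
  simp [prodA]

theorem prodB_succ (p : Fin N) : prodB ε L (p + 1)
    = Ring.inverse (shift ε (xi N * q ^ (2 * ((p : ℕ) + 1))) (piv L p)) * prodB ε L p := by
  simp [prodB]

theorem isUnit_prodA (hu : ∀ p, IsUnit (piv L p)) (m : ℕ) : IsUnit (prodA ε L m) := by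
  induction m with
  | zero => exact isUnit_one
  | succ m ih =>
    rw [prodA]
    split_ifs
    · exact ih.mul (isUnit_shift ε (xi_mul_q_pow_ne_zero _ _) (hu _))
    · exact ih

theorem isUnit_prodB (hu : ∀ p, IsUnit (piv L p)) (m : ℕ) : IsUnit (prodB ε L m) := by
  induction m with
  | zero => exact isUnit_one
  | succ m ih =>
    rw [prodB]
    split_ifs
    · exact (isUnit_shift ε (xi_mul_q_pow_ne_zero _ _) (hu _)).ringInverse.mul ih
    · exact ih

theorem manin_schur (hA : TypeA ε L) (hu : ∀ p, IsUnit (piv L p)) (m : ℕ) (hm : 2 * m ≤ N) :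
    Manin q (shiftHom ε (q ^ 2) (pow_ne_zero 2 q_ne_zero)) (schur L m) m := by
  induction m with
  | zero => exact hA.manin
  | succ m ih =>
    exact (ih (by omega)).schur_succ (p := ⟨m, by omega⟩) q_ne_zero (shift_injective ε (pow_ne_zero 2 q_ne_zero))
      (by simp only; omega) (hu _)

/-- The matrix `D L(uξ)ᵗ D⁻¹` with the order of its rows and columns reversed. -/
def revTr (ε : Sgn) (L : Matrix (Fin N) (Fin N) A⟦X⟧) : Matrix (Fin N) (Fin N) A⟦X⟧ :=
  Matrix.of fun i j => (qbar j * (qbar i)⁻¹) • shift ε (xi N) (L j i)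

theorem conj_mul_inverse_mul {R : Type*} [Ring R] {a b c : R} (ha : IsUnit a) (hb : IsUnit b)
    (hc : IsUnit c) (x y : R) : a * x * b * Ring.inverse (a * c * b) * (a * y * b)
      = a * (x * Ring.inverse c * y) * b := by
  rw [Ring.inverse_mul (Or.inr hb), Ring.inverse_mul (Or.inr hc)]
  have h1 := Ring.mul_inverse_cancel b hb
  have h2 := Ring.inverse_mul_cancel a ha
  calc a * x * b * (Ring.inverse b * (Ring.inverse c * Ring.inverse a)) * (a * y * b)
      = a * x * (b * Ring.inverse b) * Ring.inverse c * (Ring.inverse a * a) * y * b := by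
        simp only [mul_assoc]
    _ = _ := by rw [h1, h2]; simp only [mul_assoc, mul_one]

/-- The outer factors A and B pass unchanged through a Schur complement, so each step acts on the
transpose of the m-th Schur complement of L at the argument uξq^{2m}. Flipping the order of its
factors there adds one pivot to A and one inverse pivot to B. -/
theorem schur_revTr (hA : TypeA ε L) (hu : ∀ p, IsUnit (piv L p)) (m : ℕ) (hm : 2 * m ≤ N)
    (i j : Fin N) (hi : m ≤ i) (hi' : (i : ℕ) + m < N) (hj : m ≤ j) (hj' : (j : ℕ) + m < N) :
    schur (revTr ε L) m i j = (qbar j * (qbar i)⁻¹) •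
      (prodA ε L m * shift ε (xi N * q ^ (2 * m)) (schur L m j i) * prodB ε L m) := by
  induction m generalizing i j with
  | zero => simp [schur_zero, revTr, prodA, prodB]
  | succ m ih =>
    obtain ⟨p, rfl⟩ : ∃ p : Fin N, (p : ℕ) = m := ⟨⟨m, by omega⟩, rfl⟩
    have ih' := ih (by omega)
    have hx := xi_mul_q_pow_ne_zero N (2 * (p : ℕ))
    have hq2 : q ^ 2 ≠ 0 := pow_ne_zero 2 q_ne_zero
    have hpi := qbar_ne_zero i
    have hpp := qbar_ne_zero p
    have hM := manin_schur hA hu p (by omega)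
    -- The difference is what elimination yields in a transpose; the Manin relations express it
    -- through the true Schur complement at uq^2.
    have hflip : schur L p j i - schur L p p i * Ring.inverse (piv L p) * schur L p j p
        = piv L p * shift ε (q ^ 2) (schur L (p + 1) j i)
          * Ring.inverse (shift ε (q ^ 2) (piv L p)) := by
      rw [Ring.eq_mul_inverse_iff_mul_eq _ _ _ (isUnit_shift ε hq2 (hu p)), schur_succ]
      refine flip_schur_mul q_ne_zero (hu p) i j (hM.same p j p le_rfl ?_ ?_ ?_ le_rfl ?_ ?_)
        (hM.swap p j p i le_rfl ?_ ?_ ?_ le_rfl ?_ ?_ ?_)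
      all_goals
        try simp only [Fin.lt_def, ne_eq, Fin.ext_iff, Fin.val_rev]
        omega
    have hpiv : piv (revTr ε L) p = prodA ε L p * shift ε (xi N * q ^ (2 * (p : ℕ))) (piv L p)
        * prodB ε L p := by
      rw [piv, ih' p p (by omega) (by omega) (by omega) (by omega), mul_inv_cancel₀ hpp, one_smul]
      rfl
    rw [schur_succ, hpiv, ih' i j (by omega) (by omega) (by omega) (by omega),
      ih' i p (by omega) (by omega) (by omega) (by omega),
      ih' p j (by omega) (by omega) (by omega) (by omega), smul_mul_assoc, smul_mul_smul_comm,
      conj_mul_inverse_mul (isUnit_prodA hu _) (isUnit_prodB hu _) (isUnit_shift ε hx (hu p))]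
    have hs : qbar p * (qbar i)⁻¹ * (qbar j * (qbar p)⁻¹) = qbar j * (qbar i)⁻¹ := by
      field_simp
    rw [hs, ← smul_sub, ← sub_mul, ← mul_sub]
    congr 1
    have h3 := congrArg (shiftHom ε _ hx) hflip
    simp only [map_sub, map_mul, shiftHom_apply] at h3
    rw [shift_inverse ε hx (hu p), shift_inverse ε hx (isUnit_shift ε hq2 (hu p)), shift_shift,
      shift_shift] at h3
    have he : xi N * q ^ (2 * (p : ℕ)) * q ^ 2 = xi N * q ^ (2 * ((p : ℕ) + 1)) := by ring
    rw [he] at h3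
    rw [h3, prodA_succ, prodB_succ]
    simp only [mul_assoc]

theorem isUnit_piv_revTr (hA : TypeA ε L) (hu : ∀ p, IsUnit (piv L p)) (p : Fin N)
    (hp : 2 * (p : ℕ) < N) : IsUnit (piv (revTr ε L) p) := by
  rw [piv, schur_revTr hA hu p (by omega) p p (by omega) (by omega) (by omega) (by omega),
    mul_inv_cancel₀ (qbar_ne_zero p), one_smul]
  exact ((isUnit_prodA hu _).mul (isUnit_shift ε (xi_mul_q_pow_ne_zero _ _) (hu p))).mul
    (isUnit_prodB hu _)

theorem sum_revTr_mul {z : A⟦X⟧} (hz : IsZ ε L z) (i k : Fin N) :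
    ∑ j : Fin N, revTr ε L i.rev j.rev * L j k = if i = k then z else 0 := by
  have := congrFun (congrFun hz.2 i) k
  rw [Matrix.mul_apply, Matrix.diagonal_apply] at this
  rw [← this]
  refine Finset.sum_congr rfl fun j _ => ?_
  rw [D_mul_mul_DInv_apply, revTr, Matrix.of_apply, qbar_rev, qbar_rev, inv_inv, mul_comm (qbar i)]

/-- Start from ML = z. Elimination in `revTr` subtracts left multiples of the row p' of M,
elimination in L subtracts right multiples of its column p; for the surviving indices the product
has zeros at both places, so the corrections vanish. -/
theorem sum_schur_revTr_mul {z : A⟦X⟧} (hz : IsZ ε L z) (m : ℕ) (hm : 2 * m ≤ N) (i k : Fin N)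
    (hi : m ≤ i) (hk : (k : ℕ) + m < N) :
    ∑ j : Fin N, schur (revTr ε L) m i.rev j.rev * schur L m j k = if i = k then z else 0 := by
  induction m generalizing i k with
  | zero => exact sum_revTr_mul hz i k
  | succ m ih =>
    obtain ⟨p, rfl⟩ : ∃ p : Fin N, (p : ℕ) = m := ⟨⟨m, by omega⟩, rfl⟩
    have ih' := ih (by omega)
    have hL : ∀ i k : Fin N, (p : ℕ) + 1 ≤ i → (k : ℕ) + p + 1 < N →
        ∑ j : Fin N, schur (revTr ε L) (p + 1) i.rev j.rev * schur L p j k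
          = if i = k then z else 0 := by
      intro i k hi hk
      simp only [schur_succ, sub_mul, Finset.sum_sub_distrib, mul_assoc, ← Finset.mul_sum]
      rw [ih' i k (by omega) (by omega)]
      have h2 := ih' p.rev k (by rw [Fin.val_rev]; omega) (by omega)
      rw [Fin.rev_rev, if_neg (by simp only [Fin.ext_iff, Fin.val_rev]; omega)] at h2
      rw [h2, mul_zero, mul_zero, sub_zero]
    have hz0 : ∑ j : Fin N, schur (revTr ε L) (p + 1) i.rev j.rev
        * (schur L p j p * Ring.inverse (piv L p) * schur L p p k) = 0 := by
      simp only [← mul_assoc, ← Finset.sum_mul]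
      rw [hL i p hi (by omega), if_neg (by simp only [Fin.ext_iff]; omega), zero_mul, zero_mul]
    have : ∀ j, schur L (p + 1) j k
        = schur L p j k - schur L p j p * Ring.inverse (piv L p) * schur L p p k :=
      fun j => schur_succ L p j k
    simp only [this, mul_sub, Finset.sum_sub_distrib]
    rw [hL i k hi (by omega), hz0, sub_zero]

/-- The expression of `z(u)` in terms of the pivots. -/
theorem IsZ.eq_prod {z : A⟦X⟧} (hz : IsZ ε L z) (hA : TypeA ε L) (hu : ∀ p, IsUnit (piv L p))
    (m : Fin N) (hm : 2 * (m : ℕ) < N) :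
    z = prodA ε L m * shift ε (xi N * q ^ (2 * (m : ℕ))) (piv L m) * prodB ε L m
      * piv L m.rev := by
  have hrev : (m.rev : ℕ) = N - 1 - m := by rw [Fin.val_rev]; omega
  -- With the row m of the reduced `revTr` fixed, elimination in L alone continues to m', because
  -- this row pairs to zero with every column before m'.
  have key : ∀ t : ℕ, (m : ℕ) ≤ t → t ≤ (m.rev : ℕ) → ∀ k : Fin N, k ≤ m.rev →
      ∑ j : Fin N, schur (revTr ε L) m m j.rev * schur L t j k = if m.rev = k then z else 0 := by
    intro t ht
    induction t, ht using Nat.le_induction with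
    | base =>
      intro h k hk
      have := sum_schur_revTr_mul hz m (by omega) m.rev k h (by
        have : (k : ℕ) ≤ m.rev := hk
        omega)
      rwa [Fin.rev_rev] at this
    | succ t ht ih =>
      intro h k hk
      obtain ⟨p, rfl⟩ : ∃ p : Fin N, (p : ℕ) = t := ⟨⟨t, by omega⟩, rfl⟩
      have ih' := ih (by omega)
      have hz0 : ∑ j : Fin N, schur (revTr ε L) m m j.rev
          * (schur L p j p * Ring.inverse (piv L p) * schur L p p k) = 0 := by
        simp only [← mul_assoc, ← Finset.sum_mul]
        rw [ih' p (by rw [Fin.le_def]; omega), if_neg (by simp only [Fin.ext_iff]; omega), zero_mul,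
          zero_mul]
      simp only [schur_succ, mul_sub, Finset.sum_sub_distrib]
      rw [ih' k hk, hz0, sub_zero]
  have h1 := key m.rev (by omega) le_rfl m.rev le_rfl
  -- Only j = m' contributes: smaller j are rows already eliminated in L, larger j correspond to
  -- columns already eliminated in `revTr`.
  rw [if_pos rfl, Finset.sum_eq_single m.rev] at h1
  · rw [← h1, Fin.rev_rev, schur_revTr hA hu m (by omega) m m le_rfl (by omega) le_rfl (by omega),
      mul_inv_cancel₀ (qbar_ne_zero m), one_smul]
    rfl
  · intro j _ hj
    rcases lt_or_gt_of_ne hj with h | h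
    · rw [schur_row_eq_zero m.rev.is_le' (fun p _ => hu p) j m.rev h, mul_zero]
    · rw [schur_col_eq_zero m.is_le' (fun p hp => isUnit_piv_revTr hA hu p (by omega)) m j.rev
        (by have : (m.rev : ℕ) < j := h
            rw [Fin.val_rev]; omega), zero_mul]
  · simp

/-- Associativity of LML, together with LM = ML = z. -/
theorem IsZ.commute {z : A⟦X⟧} (hz : IsZ ε L z) (i j : Fin N) : Commute z (L i j) := by
  set M := DMat N A * tr (L.map (shift ε (xi N))) * DInv N A
  have h1 : L * M = Matrix.diagonal fun _ => z := hz.1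
  have h2 : M * L = Matrix.diagonal fun _ => z := hz.2
  have : (L * M) * L = L * (M * L) := Matrix.mul_assoc _ _ _
  rw [h1, h2] at this
  have := congrFun (congrFun this i) j
  rwa [Matrix.diagonal_mul, Matrix.mul_diagonal] at this

theorem commute_ringInverse {R : Type*} [MonoidWithZero R] {z a : R} (h : Commute z a) :
    Commute z (Ring.inverse a) := by
  by_cases ha : IsUnit a
  · obtain ⟨u, rfl⟩ := ha
    rw [Ring.inverse_unit]
    exact h.units_inv_right
  · rw [Ring.inverse_non_unit _ ha]
    exact Commute.zero_right z

theorem commute_schur {R : Type} [Ring R] {L : Matrix (Fin N) (Fin N) R} {z : R} (s : ℕ)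
    (h : ∀ i j : Fin N, (i : ℕ) ≤ s → (j : ℕ) ≤ s → Commute z (L i j)) (m : ℕ) (hm : m ≤ s) (i j : Fin N)
    (hi : (i : ℕ) ≤ s) (hj : (j : ℕ) ≤ s) : Commute z (schur L m i j) := by
  induction m generalizing i j with
  | zero => exact h i j hi hj
  | succ m ih =>
    by_cases hN : m < N
    · obtain ⟨p, rfl⟩ : ∃ p : Fin N, (p : ℕ) = m := ⟨⟨m, hN⟩, rfl⟩
      have ih' := ih (by omega)
      rw [schur_succ]
      exact (ih' i j hi hj).sub_right (((ih' i p hi (by omega)).mul_right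
        (commute_ringInverse (ih' p p (by omega) (by omega)))).mul_right (ih' p j (by omega) hj))
    · rw [schur, dif_neg hN]
      exact ih (by omega) i j hi hj

end Chain

/-! ### Commutation of a block with a Schur complement -/

section Block

variable {m : Type} [DecidableEq m] {B : Type} [Ring B]

/-- The matrix `X ⊗ 1`. -/
def inFst (X : Matrix m m B) : Matrix (m × m) (m × m) B :=
  Matrix.of fun y z => if y.2 = z.2 then X y.1 z.1 else 0

/-- The matrix `1 ⊗ X`. -/
def inSnd (X : Matrix m m B) : Matrix (m × m) (m × m) B :=
  Matrix.of fun y z => if y.1 = z.1 then X y.2 z.2 else 0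

theorem inFst_one : inFst (1 : Matrix m m B) = 1 := by
  ext ⟨i, k⟩ ⟨j, l⟩
  simp only [inFst, Matrix.of_apply, Matrix.one_apply, Prod.mk.injEq]
  split_ifs <;> simp_all

theorem inSnd_one : inSnd (1 : Matrix m m B) = 1 := by
  ext ⟨i, k⟩ ⟨j, l⟩
  simp [inSnd, Matrix.one_apply, ite_and]

variable [Fintype m]

theorem inFst_mul (X Y : Matrix m m B) : inFst (X * Y) = inFst X * inFst Y := by
  ext ⟨i, k⟩ ⟨j, l⟩
  simp [inFst, Matrix.mul_apply, Fintype.sum_prod_type]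

theorem inSnd_mul (X Y : Matrix m m B) : inSnd (X * Y) = inSnd X * inSnd Y := by
  ext ⟨i, k⟩ ⟨j, l⟩
  simp [inSnd, Matrix.mul_apply, Fintype.sum_prod_type]

theorem inFst_mul_inSnd_apply (X Y : Matrix m m B) (y z : m × m) :
    (inFst X * inSnd Y) y z = X y.1 z.1 * Y y.2 z.2 := by
  obtain ⟨i, k⟩ := y
  obtain ⟨j, l⟩ := z
  simp [inFst, inSnd, Matrix.mul_apply, Fintype.sum_prod_type]

theorem inSnd_mul_inFst_apply (X Y : Matrix m m B) (y z : m × m) :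
    (inSnd X * inFst Y) y z = X y.2 z.2 * Y y.1 z.1 := by
  obtain ⟨i, k⟩ := y
  obtain ⟨j, l⟩ := z
  simp [inFst, inSnd, Matrix.mul_apply, Fintype.sum_prod_type]

/-- Multiplying the RLL relation by the inverse of the second factor on both sides moves R between X
and that inverse. -/
theorem inverse_exchange {R : Matrix (m × m) (m × m) B} {X X' K' : Matrix m m B}
    (hR : R * (inFst X * inSnd X') = inSnd X' * inFst X * R) (hK : X' * K' = 1)
    (hK' : K' * X' = 1) : inSnd K' * R * inFst X = inFst X * R * inSnd K' := by
  have h1 : inSnd X' * inSnd K' = 1 := by rw [← inSnd_mul, hK, inSnd_one]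
  have h2 : inSnd K' * inSnd X' = 1 := by rw [← inSnd_mul, hK', inSnd_one]
  calc inSnd K' * R * inFst X
      = inSnd K' * (R * (inFst X * inSnd X')) * inSnd K' := by
        simp only [Matrix.mul_assoc, h1, Matrix.mul_one]
    _ = inFst X * R * inSnd K' := by
        rw [hR]
        simp only [← Matrix.mul_assoc, h2, Matrix.one_mul]

theorem inverse_relation {R : Matrix (m × m) (m × m) B} {X X' K K' : Matrix m m B}
    (hR : R * (inFst X * inSnd X') = inSnd X' * inFst X * R) (hX : X * K = 1) (hX' : K * X = 1)
    (hK : X' * K' = 1) (hK' : K' * X' = 1) :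
    inFst K * inSnd K' * R = R * (inSnd K' * inFst K) := by
  have h1 : inFst X * inFst K = 1 := by rw [← inFst_mul, hX, inFst_one]
  have h2 : inFst K * inFst X = 1 := by rw [← inFst_mul, hX', inFst_one]
  calc inFst K * inSnd K' * R
      = inFst K * (inSnd K' * R * inFst X) * inFst K := by
        simp only [Matrix.mul_assoc, h1, Matrix.mul_one]
    _ = R * (inSnd K' * inFst K) := by
        rw [inverse_exchange hR hK hK']
        simp only [← Matrix.mul_assoc, h2, Matrix.one_mul]

variable {𝕜 : Type*} [Field 𝕜] [Algebra 𝕜 B]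

/-- If `X(u)`, `X(v)` satisfy an `RLL` relation and the additional row `c`, column `b` and corner
`d` satisfy compatible relations, then `X(u)` commutes with the Schur complement of `X(v)`. -/
theorem commute_schur_complement {R : Matrix (m × m) (m × m) B} {X X' K' : Matrix m m B}
    {c c' b b' : m → B} {d' : B} {e f g : 𝕜} (he : e ≠ 0)
    (hR : R * (inFst X * inSnd X') = inSnd X' * inFst X * R) (hK : X' * K' = 1)
    (hK' : K' * X' = 1)
    (hc : ∀ i j l, e • (X i j * c' l) + f • (c j * X' i l)
      = ∑ a, ∑ b, c' b * X i a * R (a, b) (j, l))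
    (hb : ∀ i k j, ∑ a, ∑ p, R (i, k) (a, p) * (X a j * b' p)
      = e • (b' k * X i j) + g • (X' k j * b i))
    (hd : ∀ i j, e • (X i j * d') + f • (c j * b' i) = e • (d' * X i j) + g • (c' j * b i))
    (i j : m) : Commute (X i j) (d' - ∑ p, ∑ r, c' p * K' p r * b' r) := by
  set s := ∑ p, ∑ r, c' p * K' p r * b' r with hs
  set C2 : Matrix m (m × m) B := Matrix.of fun i z => if i = z.1 then c' z.2 else 0 with hC2
  set B2 : Matrix (m × m) m B := Matrix.of fun y j => if y.1 = j then b' y.2 else 0 with hB2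
  set V : Matrix m (m × m) B := Matrix.of fun i z => c z.1 * X' i z.2 with hV
  set W : Matrix (m × m) m B := Matrix.of fun y j => X' y.2 j * b y.1 with hW
  have h1 : e • (X * C2) + f • V = C2 * inFst X * R := by
    ext i ⟨j, l⟩
    have : ∀ z, (C2 * inFst X) i z = c' z.2 * X i z.1 := by
      rintro ⟨a, b⟩
      simp [hC2, inFst, Matrix.mul_apply, Fintype.sum_prod_type]
    rw [Matrix.mul_apply (M := C2 * inFst X), Fintype.sum_prod_type]
    simp only [this]
    rw [← hc]
    simp [hC2, hV, Matrix.mul_apply]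
  have h2 : R * (inFst X * B2) = e • (B2 * X) + g • W := by
    ext ⟨i, k⟩ j
    have : ∀ z, (inFst X * B2) z j = X z.1 j * b' z.2 := by
      rintro ⟨a, b⟩
      simp [hB2, inFst, Matrix.mul_apply, Fintype.sum_prod_type]
    rw [Matrix.mul_apply (M := R), Fintype.sum_prod_type]
    simp only [this]
    rw [hb]
    simp [hB2, hW, Matrix.mul_apply]
  have h3 : C2 * inSnd K' * B2 = Matrix.diagonal fun _ => s := by
    ext i j
    simp only [hC2, inSnd, hB2, Matrix.mul_apply, Fintype.sum_prod_type, Matrix.of_apply, ite_mul,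
      zero_mul, mul_ite, mul_zero, Matrix.diagonal_apply, hs]
    simp only [Finset.sum_ite_eq', Finset.sum_ite_irrel, Finset.sum_const_zero, Finset.mem_univ,
      if_true]
    rw [Finset.sum_comm]
    split_ifs <;> simp [Finset.sum_mul]
  have h4 : V * inSnd K' * B2 = Matrix.of fun i j => c j * b' i := by
    ext i j
    have : ∀ z, (V * inSnd K') i z = if i = z.2 then c z.1 else 0 := by
      rintro ⟨a, b⟩
      have h := congrFun (congrFun hK i) b
      rw [Matrix.mul_apply, Matrix.one_apply] at h
      simp only [hV, inSnd, Matrix.mul_apply, Fintype.sum_prod_type, Matrix.of_apply, mul_ite,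
        mul_zero]
      rw [Finset.sum_comm]
      simp only [Finset.sum_ite_eq', Finset.mem_univ, if_true, mul_assoc, ← Finset.mul_sum, h,
        mul_ite, mul_one, mul_zero]
    rw [Matrix.mul_apply, Fintype.sum_prod_type]
    simp only [this]
    simp [hB2]
  have h5 : C2 * inSnd K' * W = Matrix.of fun i j => c' j * b i := by
    ext i j
    have h : ∀ l, ∑ k, (C2 * inSnd K') i (l, k) * X' k j = if i = l then c' j else 0 := by
      intro l
      have h' : ∀ k, (C2 * inSnd K') i (l, k) = if i = l then ∑ p, c' p * K' p k else 0 := by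
        intro k
        simp only [hC2, inSnd, Matrix.mul_apply, Fintype.sum_prod_type, Matrix.of_apply, ite_mul,
          zero_mul, mul_ite, mul_zero]
        simp only [Finset.sum_ite_irrel, Finset.sum_const_zero]
        simp
      simp only [h']
      split_ifs
      · simp only [Finset.sum_mul]
        rw [Finset.sum_comm]
        simp only [mul_assoc, ← Finset.mul_sum]
        simp only [← Matrix.mul_apply, hK', Matrix.one_apply, mul_ite, mul_one, mul_zero,
          Finset.sum_ite_eq', Finset.mem_univ, if_true]
      · simp
    rw [Matrix.mul_apply, Fintype.sum_prod_type]
    simp only [hW, Matrix.of_apply, ← mul_assoc, ← Finset.sum_mul, h, ite_mul, zero_mul]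
    simp
  -- The row c'K'b' is carried across X using the row relation, `inverse_exchange` and the column
  -- relation. The leftover terms lose K' against X' and match those in the relation for the corner
  -- d', so subtraction leaves a commutator.
  have key : e • (X * Matrix.diagonal fun _ => s) + f • Matrix.of (fun i j => c j * b' i)
      = e • (Matrix.diagonal (fun _ => s) * X) + g • Matrix.of (fun i j => c' j * b i) := by
    rw [← h3, ← h4, ← h5]
    calc e • (X * (C2 * inSnd K' * B2)) + f • (V * inSnd K' * B2)
        = (e • (X * C2) + f • V) * inSnd K' * B2 := by
          simp only [Matrix.add_mul, Matrix.smul_mul, Matrix.mul_assoc]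
      _ = C2 * (inFst X * R * inSnd K') * B2 := by rw [h1]; simp only [Matrix.mul_assoc]
      _ = C2 * inSnd K' * (R * (inFst X * B2)) := by
          rw [← inverse_exchange hR hK hK']; simp only [Matrix.mul_assoc]
      _ = _ := by
          rw [h2]
          simp only [Matrix.mul_add, Matrix.mul_smul, Matrix.mul_assoc]
  have h6 := congrFun (congrFun key i) j
  simp only [Matrix.add_apply, Matrix.smul_apply, Matrix.mul_diagonal, Matrix.diagonal_mul,
    Matrix.of_apply] at h6
  have h7 := congrArg₂ (· - ·) (hd i j) h6
  simp only [add_sub_add_right_eq_sub, ← smul_sub, ← mul_sub, ← sub_mul] at h7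
  exact smul_right_injective _ he h7

end Block

/-! ### The leading blocks of a matrix -/

section Leading

variable {N : ℕ} {S : Type} [Ring S]

/-- T - 1 lowers the weight w strictly, hence is nilpotent. The weights i and i' serve lower and
upper triangular matrices respectively. -/
theorem isUnit_of_unitriangular {m : ℕ} (w : Fin m → ℕ) (hw : ∀ i, w i < m)
    (T : Matrix (Fin m) (Fin m) S) (hT : ∀ i j, w i ≤ w j → T i j = if i = j then 1 else 0) :
    IsUnit T := by
  have hn : ∀ k : ℕ, ∀ i j, w i < w j + k → ((T - 1) ^ k) i j = 0 := by
    intro k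
    induction k with
    | zero =>
      intro i j hij
      rw [pow_zero, Matrix.one_apply, if_neg]
      rintro rfl
      omega
    | succ k ih =>
      intro i j hij
      rw [pow_succ, Matrix.mul_apply]
      refine Finset.sum_eq_zero fun l _ => ?_
      by_cases h : w i < w l + k
      · rw [ih i l h, zero_mul]
      · rw [Matrix.sub_apply, hT l j (by omega), Matrix.one_apply, sub_self, mul_zero]
  have : IsNilpotent (T - 1) := by
    refine ⟨m, ?_⟩
    ext i j
    exact hn m i j (by have := hw i; omega)
  simpa using this.isUnit_one_add

theorem sum_ite_lt_eq_sum_castLE {M : Type*} [AddCommMonoid M] {m : ℕ} (hm : m ≤ N)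
    (f : Fin N → M) :
    ∑ k : Fin N, (if (k : ℕ) < m then f k else 0) = ∑ k : Fin m, f (Fin.castLE hm k) := by
  symm
  refine Fintype.sum_of_injective (Fin.castLE hm) (Fin.castLE_injective hm) _ _ ?_ ?_
  · intro i hi
    rw [if_neg]
    intro h
    exact hi ⟨⟨i, h⟩, rfl⟩
  · intro i
    simp

variable {L : Matrix (Fin N) (Fin N) S}

theorem eq_sum_castLE {m : ℕ} (hm : m ≤ N) (i j : Fin N) :
    L i j = schur L m i j + ∑ k : Fin m, schur L k i (Fin.castLE hm k)
      * Ring.inverse (piv L (Fin.castLE hm k)) * schur L k (Fin.castLE hm k) j := by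
  rw [schur_eq_sub_sum L m hm i j, sum_ite_lt_eq_sum_castLE hm
    (fun k => schur L k i k * Ring.inverse (piv L k) * schur L k k j)]
  simp

/-- The inverse of a leading block together with its relation to the pivots. -/
theorem exists_inverse_leading_block (hu : ∀ p, IsUnit (piv L p)) {m : ℕ} (hm : m ≤ N) :
    ∃ G : Matrix (Fin m) (Fin m) S,
      L.submatrix (Fin.castLE hm) (Fin.castLE hm) * G = 1 ∧
      G * L.submatrix (Fin.castLE hm) (Fin.castLE hm) = 1 ∧
      (∀ i j : Fin N, m ≤ i → m ≤ j → schur L m i j = L i j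
        - ∑ p, ∑ r, L i (Fin.castLE hm p) * G p r * L (Fin.castLE hm r) j) ∧
      ∀ p : Fin m, (p : ℕ) + 1 = m → piv L (Fin.castLE hm p) * G p p = 1 := by
  set ι := Fin.castLE hm with hι
  set X := L.submatrix ι ι with hX
  set F := (gaussF L).submatrix ι ι with hF
  set E := (gaussE L).submatrix ι ι with hE
  set H : Matrix (Fin m) (Fin m) S := Matrix.diagonal fun i => piv L (ι i) with hH
  set J : Matrix (Fin m) (Fin m) S := Matrix.diagonal fun i => Ring.inverse (piv L (ι i)) with hJ
  have hG := isGauss_piv hu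
  have hFE : X = F * H * E := by
    ext i j
    rw [hX, Matrix.submatrix_apply, eq_sum_castLE (L := L) hm,
      schur_row_eq_zero hm (fun p _ => hu p) _ _ i.2, zero_add, Matrix.mul_apply]
    refine Finset.sum_congr rfl fun k _ => ?_
    rw [hH, Matrix.mul_diagonal, hF, hE, Matrix.submatrix_apply, Matrix.submatrix_apply, gaussF,
      gaussE, Matrix.of_apply, Matrix.of_apply, Ring.inverse_mul_cancel_right _ _ (hu _), mul_assoc]
    rfl
  have hHJ : H * J = 1 := by
    rw [hH, hJ, Matrix.diagonal_mul_diagonal, ← Matrix.diagonal_one]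
    congr 1
    ext i
    exact Ring.mul_inverse_cancel _ (hu _)
  have hJH : J * H = 1 := by
    rw [hH, hJ, Matrix.diagonal_mul_diagonal, ← Matrix.diagonal_one]
    congr 1
    ext i
    exact Ring.inverse_mul_cancel _ (hu _)
  have hFu : IsUnit F := by
    refine isUnit_of_unitriangular (fun i => i) (fun i => i.2) F fun i j hij => ?_
    split_ifs with h
    · rw [h]; exact hG.F_diag _
    · exact hG.F_lower _ _ (lt_of_le_of_ne hij fun h' => h (Fin.castLE_injective hm h'))
  have hEu : IsUnit E := by
    refine isUnit_of_unitriangular (fun i => i.rev) (fun i => i.rev.2) E fun i j hij => ?_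
    split_ifs with h
    · rw [h]; exact hG.E_diag _
    · have : j ≤ i := Fin.rev_le_rev.1 hij
      exact hG.E_upper _ _ (lt_of_le_of_ne this fun h' => h (Fin.castLE_injective hm h').symm)
  obtain ⟨Fi, hF1, hF2⟩ := isUnit_iff_exists.1 hFu
  obtain ⟨Ei, hE1, hE2⟩ := isUnit_iff_exists.1 hEu
  refine ⟨Ei * J * Fi, ?_, ?_, ?_, ?_⟩
  · rw [hFE]
    calc F * H * E * (Ei * J * Fi) = F * H * (E * Ei) * J * Fi := by simp only [mul_assoc]
      _ = F * (H * J) * Fi := by rw [hE1]; simp only [mul_assoc, one_mul]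
      _ = 1 := by rw [hHJ, mul_one, hF1]
  · rw [hFE]
    calc Ei * J * Fi * (F * H * E) = Ei * J * (Fi * F) * H * E := by simp only [mul_assoc]
      _ = Ei * (J * H) * E := by rw [hF2]; simp only [mul_assoc, one_mul]
      _ = 1 := by rw [hJH, mul_one, hE2]
  · intro i j hi hj
    set c : Matrix Unit (Fin m) S := Matrix.of fun _ p => L i (ι p) with hc
    set f : Matrix Unit (Fin m) S := Matrix.of fun _ k => schur L k i (ι k) with hf
    set b : Matrix (Fin m) Unit S := Matrix.of fun r _ => L (ι r) j with hb
    set g : Matrix (Fin m) Unit S := Matrix.of fun k _ => schur L k (ι k) j with hg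
    have hcf : c = f * E := by
      ext _ p
      rw [hc, Matrix.of_apply, eq_sum_castLE (L := L) hm, schur_col_eq_zero hm (fun p _ => hu p) _ _ p.2,
        zero_add, Matrix.mul_apply]
      refine Finset.sum_congr rfl fun k _ => ?_
      rw [hf, hE, Matrix.of_apply, Matrix.submatrix_apply, gaussE, Matrix.of_apply, mul_assoc]
      rfl
    have hbg : b = F * g := by
      ext r _
      rw [hb, Matrix.of_apply, eq_sum_castLE (L := L) hm, schur_row_eq_zero hm (fun p _ => hu p) _ _ r.2,
        zero_add, Matrix.mul_apply]
      refine Finset.sum_congr rfl fun k _ => ?_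
      rw [hg, hF, Matrix.of_apply, Matrix.submatrix_apply, gaussF, Matrix.of_apply]
      rfl
    have h1 : c * (Ei * J * Fi) * b = f * J * g := by
      rw [hcf, hbg]
      calc f * E * (Ei * J * Fi) * (F * g) = f * (E * Ei) * J * (Fi * F) * g := by
            simp only [Matrix.mul_assoc]
        _ = f * J * g := by rw [hE1, hF2, Matrix.mul_one, Matrix.mul_one]
    have h2 := congrFun (congrFun h1 ()) ()
    rw [Matrix.mul_apply] at h2
    simp only [Matrix.mul_apply (M := c), Finset.sum_mul] at h2
    rw [Finset.sum_comm] at h2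
    rw [eq_sum_castLE (L := L) hm i j, eq_sub_iff_add_eq]
    congr 1
    refine h2.trans ?_
    rw [Matrix.mul_apply]
    refine Finset.sum_congr rfl fun k _ => ?_
    rw [hJ, Matrix.mul_diagonal]
    rfl
  · intro p hp
    -- The last diagonal entry on the left is the pivot times that of the inverse block, since E is
    -- upper unitriangular; on the right it is 1.
    have h1 : H * E * (Ei * J * Fi) = Fi := by
      calc H * E * (Ei * J * Fi) = H * (E * Ei) * J * Fi := by simp only [mul_assoc]
        _ = Fi := by rw [hE1, mul_one, hHJ, one_mul]
    have h2 : Fi p p = 1 := by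
      have h3 := congrFun (congrFun hF2 p) p
      rw [Matrix.mul_apply, Finset.sum_eq_single p, Matrix.one_apply_eq] at h3
      · rwa [show F p p = 1 from hG.F_diag _, mul_one] at h3
      · intro k _ hk
        rw [show F k p = 0 from hG.F_lower _ _ (lt_of_le_of_ne (show (k : ℕ) ≤ p by omega)
          (fun h' => hk (Fin.castLE_injective hm h'))), mul_zero]
      · simp
    have h3 := congrFun (congrFun h1 p) p
    rw [h2, mul_assoc, hH, Matrix.diagonal_mul, Matrix.mul_apply, Finset.sum_eq_single p] at h3
    · rwa [show E p p = 1 from hG.E_diag _, one_mul] at h3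
    · intro k _ hk
      rw [show E p k = 0 from hG.E_upper _ _ (lt_of_le_of_ne (show (k : ℕ) ≤ p by omega)
        (fun h' => hk (Fin.castLE_injective hm h'))), zero_mul]
    · simp

end Leading

/-! ### Commutation of the pivots -/

section Pivots

variable {N : ℕ} {B : Type} [Ring B] [Algebra K B]

/-- The `R`-matrix of type `A`. -/
def RA (B : Type) [Ring B] [Algebra K B] (m : ℕ) (x : K) :
    Matrix (Fin m × Fin m) (Fin m × Fin m) B :=
  Matrix.of fun y z => algebraMap K B
    ((if z = y then dco y.1 y.2 x else 0) + (if z = (y.2, y.1) then oco y.1 y.2 x else 0))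

theorem sum_RA_mul (m : ℕ) (x : K) (y : Fin m × Fin m) (g : Fin m × Fin m → B) :
    ∑ z, RA B m x y z * g z = dco y.1 y.2 x • g y + oco y.1 y.2 x • g (y.2, y.1) := by
  simp only [RA, Matrix.of_apply, ← Algebra.smul_def, add_smul, Finset.sum_add_distrib, ite_smul,
    zero_smul, Finset.sum_ite_eq', Finset.mem_univ, if_true]

theorem sum_mul_RA (m : ℕ) (x : K) (z : Fin m × Fin m) (g : Fin m × Fin m → B) :
    ∑ y, g y * RA B m x y z = dco z.1 z.2 x • g z + oco z.2 z.1 x • g (z.2, z.1) := by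
  have : ∀ y, g y * RA B m x y z = (if y = z then dco z.1 z.2 x else 0) • g y
      + (if y = (z.2, z.1) then oco z.2 z.1 x else 0) • g y := by
    intro y
    rw [← add_smul, Algebra.smul_def, Algebra.commutes, RA, Matrix.of_apply]
    congr 3
    · by_cases h : y = z
      · simp [h]
      · simp [h, Ne.symm h]
    · by_cases h : y = (z.2, z.1)
      · simp [h]
      · have h' : z ≠ (y.2, y.1) := fun h'' => h (by rw [h''])
        simp [h, h']
  simp only [this, Finset.sum_add_distrib, ite_smul, zero_smul, Finset.sum_ite_eq', Finset.mem_univ,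
    if_true]

theorem dco_castLE {m : ℕ} (hm : m ≤ N) (i k : Fin m) (x : K) :
    dco (Fin.castLE hm i) (Fin.castLE hm k) x = dco i k x := by
  simp only [dco, Fin.ext_iff, Fin.val_castLE]

theorem oco_castLE {m : ℕ} (hm : m ≤ N) (i k : Fin m) (x : K) :
    oco (Fin.castLE hm i) (Fin.castLE hm k) x = oco i k x := by
  simp only [oco, Fin.ext_iff, Fin.lt_def, Fin.val_castLE]

variable {A : Type} [Ring A] [Algebra K A] {ε : Sgn} {L : Matrix (Fin N) (Fin N) A⟦X⟧}

/-- Because 2m ≤ N, no two of the first m indices have the form i, i', so the whole block satisfies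
an RLL relation of type A. -/
theorem TypeA.leading_block (hA : TypeA ε L) {m : ℕ} (hm : m ≤ N) (h2 : 2 * m ≤ N) {x : K}
    (hx : x ≠ 0) {X X' : Matrix (Fin m) (Fin m) A⟦X⟧}
    (hX : X = L.submatrix (Fin.castLE hm) (Fin.castLE hm)) (hX' : X' = X.map (shift ε x⁻¹)) :
    RA A⟦X⟧ m x * (inFst X * inSnd X') = inSnd X' * inFst X * RA A⟦X⟧ m x := by
  have hg : ∀ i k : Fin m, Fin.castLE hm k ≠ (Fin.castLE hm i).rev := by
    intro i k
    have := i.2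
    have := k.2
    simp only [ne_eq, Fin.ext_iff, Fin.val_castLE, Fin.val_rev]
    omega
  ext1 y z
  rw [Matrix.mul_apply, Matrix.mul_apply (N := RA A⟦X⟧ m x), sum_RA_mul, sum_mul_RA]
  simp only [inFst_mul_inSnd_apply, inSnd_mul_inFst_apply, hX', hX, Matrix.map_apply,
    Matrix.submatrix_apply]
  have := hA x hx (Fin.castLE hm y.1) (Fin.castLE hm y.2) (Fin.castLE hm z.1) (Fin.castLE hm z.2)
    (hg _ _) (hg _ _)
  rw [dco_castLE, oco_castLE, dco_castLE, oco_castLE] at this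
  exact this

theorem map_shift_mul_eq_one {m : ℕ} {a : K} (ha : a ≠ 0) {X G : Matrix (Fin m) (Fin m) A⟦X⟧}
    (h : X * G = 1) : X.map (shift ε a) * G.map (shift ε a) = 1 := by
  have := congrArg (fun M => M.map (shiftHom ε a ha)) h
  simp only [Matrix.map_mul] at this
  rw [Matrix.map_one _ (map_zero _) (map_one _)] at this
  exact this

/-- The pivot h_r is the Schur complement of the leading r × r block in the corner (r, r), and 2r <
N keeps all relations used within type A. The value x = 1 is excluded because x - 1 has to be
cancelled. -/
theorem commute_entry_shift_piv (hA : TypeA ε L) (hu : ∀ p, IsUnit (piv L p)) (r : Fin N)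
    (hr : 2 * (r : ℕ) < N) {x : K} (hx : x ≠ 0) (hx1 : x ≠ 1) (i j : Fin r) :
    Commute (L (Fin.castLE r.is_le' i) (Fin.castLE r.is_le' j)) (shift ε x⁻¹ (piv L r)) := by
  obtain ⟨G, hG1, hG2, hG3, -⟩ := exists_inverse_leading_block hu r.is_le'
  have hx' := inv_ne_zero hx
  set ι : Fin r → Fin N := Fin.castLE r.is_le' with hι
  have hlt : ∀ i : Fin r, ι i < r := fun i => i.2
  have hne : ∀ i : Fin r, ι i ≠ r := fun i => (hlt i).ne
  have hrev : ∀ i : Fin r, r ≠ (ι i).rev := by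
    intro i
    have := i.2
    simp only [hι, ne_eq, Fin.ext_iff, Fin.val_castLE, Fin.val_rev]
    omega
  have hrev2 : ∀ i k : Fin r, ι k ≠ (ι i).rev := by
    intro i k
    have := i.2
    have := k.2
    simp only [hι, ne_eq, Fin.ext_iff, Fin.val_castLE, Fin.val_rev]
    omega
  have hdr : ∀ i : Fin r, dco (ι i) r x = x - 1 := fun i => by rw [dco, if_neg (hne i)]
  have hor : ∀ i : Fin r, oco (ι i) r x = (q - q⁻¹) * x := fun i => by
    rw [oco, if_neg (hne i), if_pos (hlt i)]
  have hor' : ∀ i : Fin r, oco r (ι i) x = q - q⁻¹ := fun i => by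
    rw [oco, if_neg (hne i).symm, if_neg (hlt i).asymm]
  have key := commute_schur_complement (e := x - 1) (f := (q - q⁻¹) * x) (g := q - q⁻¹)
    (sub_ne_zero.2 hx1)
    (hA.leading_block r.is_le' hr.le hx (X := L.submatrix ι ι) rfl rfl)
    (map_shift_mul_eq_one hx' hG1) (map_shift_mul_eq_one hx' hG2)
    (c := fun l => L r (ι l)) (c' := fun l => shift ε x⁻¹ (L r (ι l)))
    (b := fun l => L (ι l) r) (b' := fun l => shift ε x⁻¹ (L (ι l) r))
    (d' := shift ε x⁻¹ (L r r)) ?_ ?_ ?_ i j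
  · rw [piv, hG3 r r le_rfl le_rfl]
    have h : shift ε x⁻¹ (L r r - ∑ p, ∑ s, L r (ι p) * G p s * L (ι s) r)
        = shift ε x⁻¹ (L r r) - ∑ p, ∑ s, shift ε x⁻¹ (L r (ι p)) * shift ε x⁻¹ (G p s)
          * shift ε x⁻¹ (L (ι s) r) := by
      simp only [← shiftHom_apply ε x⁻¹ hx', map_sub, map_sum, map_mul]
    rw [h]
    exact key
  · intro i j l
    have h := hA x hx (ι i) r (ι j) (ι l) (hrev i) (hrev2 j l)
    rw [hdr, hor, hι, dco_castLE, oco_castLE] at h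
    rw [← Fintype.sum_prod_type' (fun a b => shift ε x⁻¹ (L r (ι b)) * L.submatrix ι ι i a
      * RA A⟦X⟧ r x (a, b) (j, l))]
    rw [sum_mul_RA r x (j, l) (fun y => shift ε x⁻¹ (L r (ι y.2)) * L.submatrix ι ι i y.1)]
    exact h
  · intro i k j
    have h := hA x hx (ι i) (ι k) (ι j) r (hrev2 i k) (hrev j)
    rw [hdr, hor', hι, dco_castLE, oco_castLE] at h
    rw [← Fintype.sum_prod_type' (fun a p => RA A⟦X⟧ r x (i, k) (a, p)
      * (L.submatrix ι ι a j * shift ε x⁻¹ (L (ι p) r)))]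
    rw [sum_RA_mul r x (i, k) (fun y => L.submatrix ι ι y.1 j * shift ε x⁻¹ (L (ι y.2) r))]
    exact h
  · intro i j
    have h := hA x hx (ι i) r (ι j) r (hrev i) (hrev j)
    rw [hdr, hdr, hor, hor'] at h
    exact h

theorem commute_piv_of_lt (hA : TypeA ε L) (hu : ∀ p, IsUnit (piv L p)) (p r : Fin N) (hpr : p < r)
    (hr : 2 * (r : ℕ) < N) (a b : K) : Commute (shift ε a (piv L p)) (shift ε b (piv L r)) := by
  refine commute_shift_of_commute_coeff ε (commute_coeff_of_commute_shift ε {1}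
    (Set.finite_singleton 1) fun x hx hx1 => ?_) a b
  refine (commute_schur p (fun i j hi hj => ?_) p le_rfl p p le_rfl le_rfl).symm
  exact (commute_entry_shift_piv hA hu r hr hx hx1 ⟨i, lt_of_le_of_lt hi hpr⟩
    ⟨j, lt_of_le_of_lt hj hpr⟩).symm

/-- The inverse of the leading block of size p + 1 also satisfies a relation with the R-matrix. Its
last diagonal entry is h_p^{-1}, and both sides of the relation for this entry carry the same scalar
xq - q^{-1}, nonzero for x ≠ q^{-2}. -/
theorem commute_piv_self (hA : TypeA ε L) (hu : ∀ p, IsUnit (piv L p)) (p : Fin N)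
    (hp : 2 * (p : ℕ) + 1 < N) (a b : K) : Commute (shift ε a (piv L p)) (shift ε b (piv L p)) := by
  have hm : (p : ℕ) + 1 ≤ N := p.2
  obtain ⟨G, hG1, hG2, -, hG4⟩ := exists_inverse_leading_block hu hm
  refine commute_shift_of_commute_coeff ε (commute_coeff_of_commute_shift ε {q⁻¹ * q⁻¹}
    (Set.finite_singleton _) fun x hx hx1 => ?_) a b
  have hx' := inv_ne_zero hx
  have h := inverse_relation (hA.leading_block hm (by omega) hx
    (X := L.submatrix (Fin.castLE hm) (Fin.castLE hm)) rfl rfl) hG1 hG2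
    (map_shift_mul_eq_one hx' hG1) (map_shift_mul_eq_one hx' hG2)
  set l : Fin (p + 1) := Fin.last p
  have h2 := congrFun (congrFun h (l, l)) (l, l)
  rw [Matrix.mul_apply, Matrix.mul_apply (M := RA A⟦X⟧ _ x), sum_RA_mul, sum_mul_RA] at h2
  simp only [inFst_mul_inSnd_apply, inSnd_mul_inFst_apply, dco, oco, if_true, zero_smul,
    add_zero, Matrix.map_apply] at h2
  have hne : x * q - q⁻¹ ≠ 0 := by
    intro h0
    apply hx1
    rw [Set.mem_singleton_iff, eq_mul_inv_iff_mul_eq₀ q_ne_zero]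
    exact sub_eq_zero.1 h0
  have h3 : Commute (G l l) (shift ε x⁻¹ (G l l)) := smul_right_injective _ hne h2
  have h4 : Ring.inverse (piv L p) = G l l := by
    have := hG4 l rfl
    have hl : Fin.castLE hm l = p := rfl
    rw [hl] at this
    rw [← Ring.inverse_mul_cancel_left (piv L p) (G l l) (hu p), this, mul_one]
  rw [← h4, shift_inverse ε hx' (hu p)] at h3
  have h5 := (commute_ringInverse (commute_ringInverse h3).symm).symm
  rwa [Ring.inverse_inverse (hu p), Ring.inverse_inverse (isUnit_shift ε hx' (hu p))] at h5

theorem commute_piv (hA : TypeA ε L) (hu : ∀ p, IsUnit (piv L p)) (p r : Fin N)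
    (hp : 2 * (p : ℕ) + 1 < N) (hr : 2 * (r : ℕ) < N) (a b : K) :
    Commute (shift ε a (piv L p)) (shift ε b (piv L r)) := by
  rcases lt_trichotomy p r with h | h | h
  · exact commute_piv_of_lt hA hu p r h hr a b
  · subst h
    exact commute_piv_self hA hu p hp a b
  · exact (commute_piv_of_lt hA hu r p h (by omega) b a).symm

end Pivots

/-! ### The formulas for `z(u)` -/

section Formulas

variable {N : ℕ} {A : Type} [Ring A] [Algebra K A] {ε : Sgn} {L : Matrix (Fin N) (Fin N) A⟦X⟧}

theorem prodA_eq_prod_ofFn (m : ℕ) (hm : m ≤ N) : prodA ε L m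
    = (List.ofFn fun i : Fin m =>
        shift ε (xi N * q ^ (2 * (i : ℕ))) (piv L ⟨i, i.2.trans_le hm⟩)).prod := by
  induction m with
  | zero => simp [prodA]
  | succ m ih =>
    rw [prodA_succ ⟨m, hm⟩, ih (by omega), List.ofFn_succ', List.prod_concat]
    rfl

theorem commute_prodA {x : A⟦X⟧} (m : ℕ)
    (h : ∀ (i : Fin N) (b : K), (i : ℕ) < m → Commute x (shift ε b (piv L i))) :
    Commute x (prodA ε L m) := by
  induction m with
  | zero => exact Commute.one_right x
  | succ m ih =>
    have ih' := ih fun i b hi => h i b (by omega)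
    rw [prodA]
    split_ifs
    · exact ih'.mul_right (h _ _ (Nat.lt_succ_self m))
    · exact ih'

theorem commute_prodB {x : A⟦X⟧} (m : ℕ)
    (h : ∀ (i : Fin N) (b : K), (i : ℕ) < m → Commute x (shift ε b (piv L i))) :
    Commute x (prodB ε L m) := by
  induction m with
  | zero => exact Commute.one_right x
  | succ m ih =>
    have ih' := ih fun i b hi => h i b (by omega)
    rw [prodB]
    split_ifs
    · exact (commute_ringInverse (h _ _ (Nat.lt_succ_self m))).mul_right ih'
    · exact ih'

theorem prodB_eq_prod_ofFn (hA : TypeA ε L) (hu : ∀ p, IsUnit (piv L p)) (m : ℕ)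
    (hm : 2 * m ≤ N) : prodB ε L m
    = (List.ofFn fun i : Fin m => Ring.inverse
        (shift ε (xi N * q ^ (2 * ((i : ℕ) + 1))) (piv L ⟨i, by omega⟩))).prod := by
  induction m with
  | zero => simp [prodB]
  | succ m ih =>
    have hc : Commute (Ring.inverse (shift ε (xi N * q ^ (2 * (m + 1)))
        (piv L ⟨m, by omega⟩))) (prodB ε L m) :=
      commute_prodB m fun i b hi => (commute_ringInverse
        (commute_piv hA hu i ⟨m, by omega⟩ (by omega) (by simp only; omega) b _)).symm
    rw [prodB_succ ⟨m, by omega⟩, hc.eq, ih (by omega), List.ofFn_succ', List.prod_concat]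
    rfl

theorem xi_mul_pow_eq (N m : ℕ) : xi N * q ^ m = q ^ (2 - (N : ℤ) + m) := by
  rw [xi, zpow_add₀ q_ne_zero, zpow_natCast]

/-- Here the middle index is its own mirror image and ξq^{2n} = q, so `IsZ.eq_prod` yields both
h_{n+1}(uq) and h_{n+1}(u), in this order. -/
theorem IsZ.eq_zB {n : ℕ} {L : Matrix (Fin (2 * n + 1)) (Fin (2 * n + 1)) A⟦X⟧} {z : A⟦X⟧}
    (hz : IsZ ε L z) (hA : TypeA ε L) (hu : ∀ p, IsUnit (piv L p)) : z = zB ε n (piv L) := by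
  set m : Fin (2 * n + 1) := ⟨n, by omega⟩ with hm
  have hrev : m.rev = m := by
    ext
    simp only [hm, Fin.val_rev]
    omega
  have hq : xi (2 * n + 1) * q ^ (2 * n) = q := by
    rw [xi_mul_pow_eq, ← zpow_one q, ← zpow_mul]
    congr 1
    push_cast
    ring
  have h1 := hz.eq_prod hA hu m (by simp only [hm]; omega)
  rw [hrev] at h1
  have h2 : z = prodA ε L n * shift ε q (piv L m) * prodB ε L n * piv L m := by
    rw [← hq]
    exact h1
  have hc : ∀ (i : Fin (2 * n + 1)) (a b : K), (i : ℕ) < n →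
      Commute (shift ε a (piv L m)) (shift ε b (piv L i)) := fun i a b hi =>
    (commute_piv hA hu i m (by omega) (by simp only [hm]; omega) b a).symm
  have hc1 : ∀ (i : Fin (2 * n + 1)) (b : K), (i : ℕ) < n →
      Commute (piv L m) (shift ε b (piv L i)) := fun i b hi => by
    have := hc i 1 b hi
    rwa [shift_one] at this
  have hpB : Commute (piv L m) (prodB ε L n) := commute_prodB n hc1
  have hpA : Commute (piv L m) (prodA ε L n) := commute_prodA n hc1
  have hqB : Commute (shift ε q (piv L m)) (prodB ε L n) := commute_prodB n fun i b => hc i q b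
  have hAB : Commute (prodB ε L n) (prodA ε L n) := commute_prodA n fun i b hi =>
    (commute_prodB n fun j a hj => commute_piv hA hu i j (by omega) (by omega) b a).symm
  have hzh : Commute z (piv L m) :=
    commute_schur (2 * n + 1) (fun i j _ _ => hz.commute i j) n (by omega) m m (by omega) (by omega)
  have h3 : z = prodB ε L n * prodA ε L n * shift ε q (piv L m) * piv L m := by
    rw [h2, mul_assoc (prodA ε L n), hqB.eq, ← mul_assoc, hAB.eq]
  -- Since z commutes with the invertible pivot h_{n+1}(u), that factor can be moved from the right
  -- end to the left. This reverses the order of h_{n+1}(uq) and h_{n+1}(u) without a commutation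
  -- relation between them.
  have h4 : z = piv L m * (prodB ε L n * prodA ε L n * shift ε q (piv L m)) := by
    apply (hu m).mul_left_injective
    change z * piv L m = _ * piv L m
    rw [hzh.eq, mul_assoc, ← h3]
  rw [h4, ← mul_assoc, (hpB.mul_right hpA).eq, mul_assoc,
    prodA_eq_prod_ofFn n (by omega), prodB_eq_prod_ofFn hA hu n (by omega)]
  rfl

/-- The middle pair is n, n + 1 in the counting from 1, and ξq^{2(n-1)} = 1. The last two pivots
already stand in the required order, so only pivots of the first half have to be commuted. -/
theorem IsZ.eq_zD {n : ℕ} (hn : 1 ≤ n) {L : Matrix (Fin (2 * n)) (Fin (2 * n)) A⟦X⟧} {z : A⟦X⟧}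
    (hz : IsZ ε L z) (hA : TypeA ε L) (hu : ∀ p, IsUnit (piv L p)) : z = zD ε n hn (piv L) := by
  set m : Fin (2 * n) := ⟨n - 1, by omega⟩ with hm
  have hrev : m.rev = ⟨n, by omega⟩ := by
    ext
    simp only [hm, Fin.val_rev]
    omega
  have hq : xi (2 * n) * q ^ (2 * (n - 1)) = 1 := by
    rw [xi_mul_pow_eq, ← zpow_zero q]
    congr 1
    omega
  have h1 := hz.eq_prod hA hu m (by simp only [hm]; omega)
  rw [hrev, show (m : ℕ) = n - 1 from rfl, hq, shift_one] at h1
  have hmB : Commute (piv L m) (prodB ε L (n - 1)) := commute_prodB _ fun i b hi => by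
    have := commute_piv hA hu i m (by omega) (by simp only [hm]; omega) b 1
    rw [shift_one] at this
    exact this.symm
  have hAB : Commute (prodB ε L (n - 1)) (prodA ε L (n - 1)) := commute_prodA _ fun i b hi =>
    (commute_prodB _ fun j a hj => commute_piv hA hu i j (by omega) (by omega) b a).symm
  rw [h1, mul_assoc (prodA ε L (n - 1)), hmB.eq, ← mul_assoc, ← hAB.eq, mul_assoc,
    prodA_eq_prod_ofFn (n - 1) (by omega), prodB_eq_prod_ofFn hA hu (n - 1) (by omega)]
  rfl

end Formulas

/-! ### Application to the generator matrices of the two algebras -/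

section Generators

variable {N : ℕ} {𝓡 : Mat2 N K⟦X⟧} {c : ZeroModes}

theorem constantCoeff_LMat (ε : Sgn) (i j : Fin N) :
    PowerSeries.constantCoeff (LMat 𝓡 c ε i j)
      = RingQuot.mkAlgHom K (Rel 𝓡 c) (gen (Gen.l ε i j 0)) := by
  rw [LMat, Matrix.of_apply, ← PowerSeries.coeff_zero_eq_constantCoeff_apply, PowerSeries.coeff_mk]

theorem isUnit_piv_LMat (ε : Sgn) (p : Fin N) : IsUnit (piv (LMat 𝓡 c ε) p) := by
  have hpm : ∀ i : Fin N, RingQuot.mkAlgHom K (Rel 𝓡 c) (gen (Gen.l .plus i i 0))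
      * RingQuot.mkAlgHom K (Rel 𝓡 c) (gen (Gen.l .minus i i 0)) = 1 := fun i => by
    rw [← map_mul, RingQuot.mkAlgHom_rel K (Rel.diag_plus_minus i), map_one]
  have hmp : ∀ i : Fin N, RingQuot.mkAlgHom K (Rel 𝓡 c) (gen (Gen.l .minus i i 0))
      * RingQuot.mkAlgHom K (Rel 𝓡 c) (gen (Gen.l .plus i i 0)) = 1 := fun i => by
    rw [← map_mul, RingQuot.mkAlgHom_rel K (Rel.diag_minus_plus i), map_one]
  refine isUnit_piv_of_triangular c ?_ (fun i => ?_) p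
  · cases ε
    · refine Or.inl fun i j h => ?_
      rw [constantCoeff_LMat, RingQuot.mkAlgHom_rel K (Rel.zero_plus i j h), map_zero]
    · refine Or.inr fun i j h => ?_
      rw [constantCoeff_LMat, RingQuot.mkAlgHom_rel K (Rel.zero_minus i j h), map_zero]
  · rw [constantCoeff_LMat]
    cases ε
    · exact ⟨⟨_, _, hpm i, hmp i⟩, rfl⟩
    · exact ⟨⟨_, _, hmp i, hpm i⟩, rfl⟩

/-- A formula satisfied by every admissible z gives uniqueness. Since an admissible z exists, it
must be the value of the formula, and this gives the converse implication. -/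
theorem gauss_and_isZ_iff (hN : 2 ≤ N) (h : 𝓡 = RBar N ∨ 𝓡 = RMat N) (ε : Sgn)
    (w : (Fin N → (U 𝓡 c)⟦X⟧) → (U 𝓡 c)⟦X⟧)
    (hw : ∀ z, IsZ ε (LMat 𝓡 c ε) z → z = w (piv (LMat 𝓡 c ε))) :
    ∃ F h E, IsGauss (LMat 𝓡 c ε) F h E ∧
      (∀ F' h' E', IsGauss (LMat 𝓡 c ε) F' h' E' → F' = F ∧ h' = h ∧ E' = E) ∧
      (∀ i, IsUnit (h i)) ∧ ∀ z : (U 𝓡 c)⟦X⟧, IsZ ε (LMat 𝓡 c ε) z ↔ z = w h := by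
  have hu := isUnit_piv_LMat (𝓡 := 𝓡) (c := c) ε
  refine ⟨_, _, _, isGauss_piv hu, fun F' h' E' hG => hG.unique hu, hu, fun z => ⟨hw z, ?_⟩⟩
  rintro rfl
  obtain ⟨z, hz⟩ := exists_isZ (c := c) hN h ε
  rwa [← hw z hz]

end Generators
end QAffine

end

theorem mainTheorem8 (n : ℕ) (hn : 1 ≤ n) (c : QAffine.ZeroModes) (ε : QAffine.Sgn) :
    (∀ 𝓡 : QAffine.Mat2 (2 * n + 1) (PowerSeries QAffine.K),
      𝓡 = QAffine.RBar (2 * n + 1) ∨ 𝓡 = QAffine.RMat (2 * n + 1) →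
      ∃ F h E, QAffine.IsGauss (QAffine.LMat 𝓡 c ε) F h E ∧
        (∀ F' h' E', QAffine.IsGauss (QAffine.LMat 𝓡 c ε) F' h' E' →
          F' = F ∧ h' = h ∧ E' = E) ∧
        (∀ i, IsUnit (h i)) ∧
        ∀ z : PowerSeries (QAffine.U 𝓡 c),
          QAffine.IsZ ε (QAffine.LMat 𝓡 c ε) z ↔ z = QAffine.zB ε n h) ∧
    (∀ 𝓡 : QAffine.Mat2 (2 * n) (PowerSeries QAffine.K),
      𝓡 = QAffine.RBar (2 * n) ∨ 𝓡 = QAffine.RMat (2 * n) →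
      ∃ F h E, QAffine.IsGauss (QAffine.LMat 𝓡 c ε) F h E ∧
        (∀ F' h' E', QAffine.IsGauss (QAffine.LMat 𝓡 c ε) F' h' E' →
          F' = F ∧ h' = h ∧ E' = E) ∧
        (∀ i, IsUnit (h i)) ∧
        ∀ z : PowerSeries (QAffine.U 𝓡 c),
          QAffine.IsZ ε (QAffine.LMat 𝓡 c ε) z ↔ z = QAffine.zD ε n hn h) := by
  refine ⟨fun 𝓡 h𝓡 => ?_, fun 𝓡 h𝓡 => ?_⟩
  · exact QAffine.gauss_and_isZ_iff (by omega) h𝓡 ε _ fun z hz =>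
      hz.eq_zB (QAffine.typeA_LMat h𝓡 ε) (QAffine.isUnit_piv_LMat ε)
  · exact QAffine.gauss_and_isZ_iff (by omega) h𝓡 ε _ fun z hz =>
      hz.eq_zD hn (QAffine.typeA_LMat h𝓡 ε) (QAffine.isUnit_piv_LMat ε)
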